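/- Let $\mathbb{C}_+=\{z\in\mathbb{C}:\operatorname{Re} z>0\}$ and $\overline{\mathbb{C}_+}=\{z\in\mathbb{C}:\operatorname{Re} z\ge 0\}$. A set $E\subset[0,1]$ is called of Cantor type if there are ratios $r_k\in(0,\tfrac12)$, $k\ge 0$, such that $E$ is the intersection over all $k$ of the sets $E^{(k)}$, where $E^{(0)}=[0,1]$ and $E^{(k+1)}$ arises from $E^{(k)}$, a union of $2^k$ disjoint closed intervals of equal length $r_0\cdots r_{k-1}$, by removing from the middle of each of them an open interval so that two closed intervals of length $r_0\cdots r_k$ remain. Let $\mathcal{H}^s$ denote the $s$-dimensional Hausdorff measure on $\mathbb{R}$, computed with $\operatorname{diam}(C)^s$ (no normalizing constant), and $\dim_{\mathcal H}$ the Hausdorff dimension. For every $0<s\le 1$ there exist: (i) a nowhere dense compact set $E_s\subset[0,1]$ of Cantor type, with $\mathcal{H}^s(E_s)=1$ if $s<1$, and $\dim_{\mathcal H}(E_1)=1$ if $s=1$; (ii) holomorphic functions $F,G$ on $\mathbb{C}_+$, with $G\not\equiv 0$, such that $f=e^{-F}$ and $g=G\,e^{-F}$ admit $C^\infty$-extensions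 to $\overline{\mathbb{C}_+}$ (all derivatives extend continuously to the boundary). Moreover, $f$ and $g$ vanish to infinite order at every $z\in -iE_s=\{-iy: y\in E_s\}$, i.e. the extensions and all their derivatives of every order vanish at $z$, and for every $z\in -iE_s$ there is a sequence $z_k\in\mathbb{C}_+$ with $z_k\to z$ and $g(z_k)=0$ for all $k$. -/

import Mathlib

noncomputable section

/-- The open right half plane. -/
def rightHalfPlane : Set ℂ := {z | 0 < z.re}

/-- The closed right half plane. -/
def closedRightHalfPlane : Set ℂ := {z | 0 ≤ z.re}

/-- The length of the intervals of generation `k` in the Cantor construction on `[0,1]`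
with contraction ratios `r 0, r 1, …`. -/
def cantorLength (r : ℕ → ℝ) (k : ℕ) : ℝ := ∏ i ∈ Finset.range k, r i

/-- The left end point of the `l`-th interval (`0 ≤ l < 2 ^ k`) of generation `k`.
The intervals `2 * l` and `2 * l + 1` of generation `k + 1` are what is left of the interval `l`
of generation `k` after removing an open interval in its middle: the first one shares its left end
point, the second one its right end point. -/
def cantorLeft (r : ℕ → ℝ) : ℕ → ℕ → ℝ
  | 0, _ => 0
  | k + 1, l => cantorLeft r k (l / 2) +
      if l % 2 = 0 then 0 else cantorLength r k - cantorLength r (k + 1)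

/-- The `l`-th closed interval of generation `k`. -/
def cantorInterval (r : ℕ → ℝ) (k l : ℕ) : Set ℝ :=
  Set.Icc (cantorLeft r k l) (cantorLeft r k l + cantorLength r k)

/-- Sets of Cantor type in `[0,1]`: starting from `[0,1]`, an open middle interval is removed
from each of the `2 ^ k` closed intervals of generation `k`, leaving two closed intervals of
`r k` times the length, where `0 < r k < 1 / 2`; the set is the intersection of all generations. -/
def IsCantorType (E : Set ℝ) : Prop :=
  ∃ r : ℕ → ℝ, (∀ k, 0 < r k ∧ r k < 1 / 2) ∧
    E = ⋂ k : ℕ, ⋃ l ∈ Finset.range (2 ^ k), cantorInterval r k l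

/-- `h'` is a `C^∞` extension to the closed right half plane of the function `h` on the open one
(smoothness in the real sense, all derivatives existing and continuous up to the boundary). -/
def IsSmoothExtension (h h' : ℂ → ℂ) : Prop :=
  Set.EqOn h' h rightHalfPlane ∧
    ContDiffOn ℝ ((⊤ : ℕ∞) : WithTop ℕ∞) h' closedRightHalfPlane

/-- All derivatives of `h` on the closed right half plane, including `h` itself,
vanish at the point `p`. -/
def VanishesToInfiniteOrderAt (h : ℂ → ℂ) (p : ℂ) : Prop :=
  ∀ m : ℕ, iteratedFDerivWithin ℝ m h closedRightHalfPlane p = 0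

end

/-!
The set is `E = cantorTypeSet r` for suitable ratios, and everything is built from the lengths
`L k = cantorLength r k` and the end points of its generations. Two properties of `r` are used:
`L k` decays at most exponentially, and `∑ (k + 1) ^ 3 * (2 ^ k * L k)` converges. For `s < 1` the
ratio `2 ^ (-1 / s)` is constant; for `s = 1` the total lengths are `2 ^ k * L k = (k + 1) ^ (-5)`.

*Size of `E`.* Coverings by the generations bound the Hausdorff measure from above. From below, the
staircase function `cantorStaircase` maps `E` onto a set containing `[0,1)`, and it is
Hölder continuous of exponent `s`, with constant `1` if `r k ^ s = 1 / 2` for all `k`. The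
Hölder estimate follows from `card_div_two_pow_le_hull_rpow`, which compares the number of
consecutive intervals of a generation with the length of their hull. It is proved by splitting
the construction into its two halves: intervals in different halves are treated by concavity of
`x ↦ x ^ s`, intervals in the same half by scaling.

*The functions.* `F` is a sum over all generations `k` and all left end points `c` of generation
`k` of `(k + 1) ^ 3 * L k / (z + i c + L k)`. Each summand has nonnegative real part on the closed
right half plane, and near the interval starting at `c`, at scale `L k`, real part at least
`(k + 1) ^ 3 / 9`. Thus `|exp (-F)| ≤ exp (-const * log ^ 3 (1 / d))` there, where `d` is the
distance to the set `leftShadow E` containing all the poles; on the closed right half plane this is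
the distance to `-i E`. `G` is a Blaschke product with zeros `L j - i * y j`, where the sequence `y` in `E`
visits each neighbourhood of each point of `E` infinitely often. Off `leftShadow E`, near this
set, it is at most `exp (O (log ^ 2 (1 / d)))`.

*Smoothness.* Call a function holomorphic off `leftShadow E` tempered if it is
`exp (o (log ^ 3 (1 / d)))`. By Cauchy's estimate this class is stable under differentiation, and
`F` and `G` belong to it. The derivative of `Q * exp (-F)` is `(Q' - Q * F') * exp (-F)`, so all
derivatives of `exp (-F)` and `G * exp (-F)` are of the form tempered times `exp (-F)`. Such
functions are `O (d ^ 2)` on the closed half plane, so that extension by `0` to `-i E` is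
differentiable, and induction gives smoothness and vanishing to infinite order.
-/

open MeasureTheory Filter Topology
open scoped ENNReal NNReal

/-! ### Combinatorics of the Cantor construction -/

theorem cantorLength_succ (r : ℕ → ℝ) (k : ℕ) :
    cantorLength r (k + 1) = cantorLength r k * r k :=
  Finset.prod_range_succ _ _

theorem cantorLength_succ' (r : ℕ → ℝ) (k : ℕ) :
    cantorLength r (k + 1) = r 0 * cantorLength (fun i => r (i + 1)) k := by
  unfold cantorLength
  rw [Finset.prod_range_succ', mul_comm]

theorem cantorLength_pos {r : ℕ → ℝ} (hr : ∀ k, 0 < r k ∧ r k < 1 / 2) (k : ℕ) :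
    0 < cantorLength r k :=
  Finset.prod_pos fun i _ => (hr i).1

theorem two_mul_cantorLength_succ_lt {r : ℕ → ℝ} (hr : ∀ k, 0 < r k ∧ r k < 1 / 2) (k : ℕ) :
    2 * cantorLength r (k + 1) < cantorLength r k := by
  rw [cantorLength_succ]
  nlinarith [cantorLength_pos hr k, (hr k).2]

theorem cantorLeft_succ (r : ℕ → ℝ) (k l : ℕ) :
    cantorLeft r (k + 1) l = cantorLeft r k (l / 2) +
      if l % 2 = 0 then 0 else cantorLength r k - cantorLength r (k + 1) := rfl

theorem cantorLeft_succ_even (r : ℕ → ℝ) (k l : ℕ) :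
    cantorLeft r (k + 1) (2 * l) = cantorLeft r k l := by
  rw [cantorLeft_succ, if_pos (by omega), show 2 * l / 2 = l by omega, add_zero]

theorem cantorLeft_succ_odd (r : ℕ → ℝ) (k l : ℕ) :
    cantorLeft r (k + 1) (2 * l + 1) =
      cantorLeft r k l + (cantorLength r k - cantorLength r (k + 1)) := by
  rw [cantorLeft_succ, if_neg (by omega), show (2 * l + 1) / 2 = l by omega]

theorem cantorLeft_add_mul_two_pow (r : ℕ → ℝ) (k j l : ℕ) :
    cantorLeft r (k + j) (l * 2 ^ j) = cantorLeft r k l := by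
  induction j with
  | zero => simp
  | succ j ih =>
    rw [show l * 2 ^ (j + 1) = 2 * (l * 2 ^ j) by ring, ← add_assoc, cantorLeft_succ_even, ih]

theorem cantorLeft_le_succ {r : ℕ → ℝ} (hr : ∀ k, 0 < r k ∧ r k < 1 / 2) (k l : ℕ) :
    cantorLeft r k (l / 2) ≤ cantorLeft r (k + 1) l ∧
      cantorLeft r (k + 1) l + cantorLength r (k + 1) ≤
        cantorLeft r k (l / 2) + cantorLength r k := by
  have h1 := two_mul_cantorLength_succ_lt hr k
  have h2 := cantorLength_pos hr (k + 1)
  rw [cantorLeft_succ]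
  split_ifs <;> constructor <;> linarith

theorem cantorInterval_succ_subset {r : ℕ → ℝ} (hr : ∀ k, 0 < r k ∧ r k < 1 / 2) (k l : ℕ) :
    cantorInterval r (k + 1) l ⊆ cantorInterval r k (l / 2) :=
  Set.Icc_subset_Icc (cantorLeft_le_succ hr k l).1 (cantorLeft_le_succ hr k l).2

theorem cantorInterval_add_subset {r : ℕ → ℝ} (hr : ∀ k, 0 < r k ∧ r k < 1 / 2) (k j l : ℕ) :
    cantorInterval r (k + j) l ⊆ cantorInterval r k (l / 2 ^ j) := by
  induction j generalizing l with
  | zero => simp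
  | succ j ih =>
    refine (cantorInterval_succ_subset hr (k + j) l).trans ?_
    rw [pow_succ', ← Nat.div_div_eq_div_mul]
    exact ih _

theorem cantorLeft_nonneg {r : ℕ → ℝ} (hr : ∀ k, 0 < r k ∧ r k < 1 / 2) (k l : ℕ) :
    0 ≤ cantorLeft r k l := by
  induction k generalizing l with
  | zero => exact le_rfl
  | succ k ih => exact (ih _).trans (cantorLeft_le_succ hr k l).1

theorem cantorLeft_add_le_one {r : ℕ → ℝ} (hr : ∀ k, 0 < r k ∧ r k < 1 / 2) (k l : ℕ) :
    cantorLeft r k l + cantorLength r k ≤ 1 := by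
  induction k generalizing l with
  | zero => simp [cantorLeft, cantorLength]
  | succ k ih => exact (cantorLeft_le_succ hr k l).2.trans (ih _)

theorem cantorLeft_mem_interval {r : ℕ → ℝ} (hr : ∀ k, 0 < r k ∧ r k < 1 / 2) (k l : ℕ) :
    cantorLeft r k l ∈ cantorInterval r k l :=
  ⟨le_rfl, le_add_of_nonneg_right (cantorLength_pos hr k).le⟩

/-- Neighbouring intervals of one generation are separated by a nonempty gap. -/
theorem cantorLeft_add_lt {r : ℕ → ℝ} (hr : ∀ k, 0 < r k ∧ r k < 1 / 2) (k l : ℕ)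
    (hl : l + 1 < 2 ^ k) :
    cantorLeft r k l + cantorLength r k < cantorLeft r k (l + 1) := by
  induction k generalizing l with
  | zero => simp at hl
  | succ k ih =>
    have h1 := two_mul_cantorLength_succ_lt hr k
    obtain ⟨q, rfl | rfl⟩ := Nat.even_or_odd' l
    · rw [cantorLeft_succ_even, cantorLeft_succ_odd]
      linarith
    · rw [show 2 * q + 1 + 1 = 2 * (q + 1) by ring, cantorLeft_succ_even, cantorLeft_succ_odd]
      have := ih q (by rw [pow_succ] at hl; omega)
      linarith

theorem cantorLeft_mono {r : ℕ → ℝ} (hr : ∀ k, 0 < r k ∧ r k < 1 / 2) (k l m : ℕ)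
    (hlm : l ≤ m) (hm : m < 2 ^ k) : cantorLeft r k l ≤ cantorLeft r k m := by
  induction m, hlm using Nat.le_induction with
  | base => exact le_rfl
  | succ m hlm ih =>
    have := cantorLeft_add_lt hr k m hm
    have := cantorLength_pos hr k
    linarith [ih (by omega)]

/-- The left half of the construction is the construction with shifted ratios, scaled by `r 0`. -/
theorem cantorLeft_left_half (r : ℕ → ℝ) (n l : ℕ) (hl : l < 2 ^ n) :
    cantorLeft r (n + 1) l = r 0 * cantorLeft (fun i => r (i + 1)) n l := by
  induction n generalizing l with
  | zero =>
    obtain rfl : l = 0 := by simpa using hl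
    simp [cantorLeft]
  | succ n ih =>
    rw [cantorLeft_succ, ih _ (by rw [pow_succ] at hl; omega),
      cantorLeft_succ (fun i => r (i + 1)), cantorLength_succ', cantorLength_succ']
    split_ifs <;> ring

/-- The right half of the construction is the construction with shifted ratios, scaled by `r 0`
and moved to the right end of `[0,1]`. -/
theorem cantorLeft_right_half (r : ℕ → ℝ) (n l : ℕ) (hl : l < 2 ^ n) :
    cantorLeft r (n + 1) (2 ^ n + l) =
      1 - r 0 + r 0 * cantorLeft (fun i => r (i + 1)) n l := by
  induction n generalizing l with
  | zero =>
    obtain rfl : l = 0 := by simpa using hl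
    simp [cantorLeft, cantorLength]
  | succ n ih =>
    have h1 : (2 ^ (n + 1) + l) / 2 = 2 ^ n + l / 2 := by rw [pow_succ]; omega
    have h2 : (2 ^ (n + 1) + l) % 2 = l % 2 := by rw [pow_succ]; omega
    rw [cantorLeft_succ, h1, h2, ih _ (by rw [pow_succ] at hl; omega),
      cantorLeft_succ (fun i => r (i + 1)), cantorLength_succ', cantorLength_succ']
    split_ifs <;> ring

/-- A stretch of `m - l + 1` consecutive intervals of generation `n` has length at least
comparable to `((m - l + 1) / 2 ^ n) ^ (1 / s)`. The constant is `1` if `1 ≤ 2 * r j ^ s` for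
all `j`. -/
theorem card_div_two_pow_le_hull_rpow {s : ℝ} (hs0 : 0 < s) (hs1 : s ≤ 1) (n : ℕ) :
    ∀ (r : ℕ → ℝ), (∀ k, 0 < r k ∧ r k < 1 / 2) → ∀ l m : ℕ, l ≤ m → m < 2 ^ n →
    ((m : ℝ) - l + 1) / 2 ^ n ≤ (∏ j ∈ Finset.range n, max 1 (1 / (2 * r j ^ s))) *
      (cantorLeft r n m + cantorLength r n - cantorLeft r n l) ^ s := by
  induction n with
  | zero =>
    intro r hr l m hlm hm
    obtain rfl : m = 0 := by simpa using hm
    obtain rfl : l = 0 := by simpa using hlm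
    simp [cantorLeft, cantorLength]
  | succ n ih =>
    intro r hr l m hlm hm
    have hr' : ∀ k, 0 < r (k + 1) ∧ r (k + 1) < 1 / 2 := fun k => hr (k + 1)
    have IH := ih (fun i => r (i + 1)) hr'
    obtain ⟨r0, r2⟩ := hr 0
    rw [Finset.prod_range_succ', cantorLength_succ']
    set M : ℝ := ∏ j ∈ Finset.range n, max 1 (1 / (2 * r (j + 1) ^ s)) with hM
    set L' := cantorLength (fun i => r (i + 1)) n with hL'
    set c' := cantorLeft (fun i => r (i + 1)) n with hc'
    have hL'0 : 0 < L' := cantorLength_pos hr' n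
    have hM0 : 0 ≤ M := Finset.prod_nonneg fun j _ => zero_le_one.trans (le_max_left _ _)
    have hrs : 0 < r 0 ^ s := Real.rpow_pos_of_pos r0 s
    -- two intervals in the same half: scale
    have same : ∀ l' m' : ℕ, l' ≤ m' → m' < 2 ^ n → ((m' : ℝ) - l' + 1) / 2 ^ (n + 1) ≤
        M * max 1 (1 / (2 * r 0 ^ s)) * (r 0 * (c' m' + L' - c' l')) ^ s := by
      intro l' m' h1 h2
      have h3 : 0 ≤ c' m' + L' - c' l' := by
        have := cantorLeft_mono hr' n l' m' h1 h2
        linarith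
      have h4 := IH l' m' h1 h2
      have h5 := le_max_right 1 (1 / (2 * r 0 ^ s))
      rw [Real.mul_rpow r0.le h3, pow_succ, ← div_div]
      have h6 : 0 ≤ (c' m' + L' - c' l') ^ s := Real.rpow_nonneg h3 s
      calc _ ≤ (M * (c' m' + L' - c' l') ^ s) / 2 := by gcongr
        _ = M * (1 / (2 * r 0 ^ s)) * (r 0 ^ s * (c' m' + L' - c' l') ^ s) := by
          field_simp
        _ ≤ _ := by gcongr
    rcases lt_or_ge m (2 ^ n) with hm1 | hm1
    · rw [cantorLeft_left_half r n m hm1, cantorLeft_left_half r n l (by omega)]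
      have := same l m hlm hm1
      rwa [show r 0 * c' m + r 0 * L' - r 0 * c' l = r 0 * (c' m + L' - c' l) by ring]
    · obtain ⟨m', rfl⟩ := Nat.exists_eq_add_of_le hm1
      have hm' : m' < 2 ^ n := by rw [pow_succ] at hm; omega
      rw [cantorLeft_right_half r n m' hm']
      rcases lt_or_ge l (2 ^ n) with hl1 | hl1
      · rw [cantorLeft_left_half r n l hl1]
        set A := 1 - c' l with hA
        set B := c' m' + L' with hB
        have hpos : 0 < 2 ^ n := by positivity
        have hA0 : 0 ≤ A := by
          have := cantorLeft_add_le_one hr' n l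
          rw [hA]; linarith
        have hB0 : 0 ≤ B := add_nonneg (cantorLeft_nonneg hr' n m') hL'0.le
        have hA1 : A ≤ 1 := sub_le_self _ (cantorLeft_nonneg hr' n l)
        have hB1 : B ≤ 1 := cantorLeft_add_le_one hr' n m'
        have e1 : ((2 : ℝ) ^ n - l) / 2 ^ n ≤ M * A ^ s := by
          have h := IH l (2 ^ n - 1) (by omega) (by omega)
          rw [Nat.cast_sub (by omega)] at h
          push_cast at h
          have h0 := cantorLeft_mono hr' n l (2 ^ n - 1) (by omega) (by omega)
          have h1 := cantorLeft_add_le_one hr' n (2 ^ n - 1)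
          calc ((2 : ℝ) ^ n - l) / 2 ^ n = ((2 : ℝ) ^ n - 1 - l + 1) / 2 ^ n := by ring
            _ ≤ _ := h
            _ ≤ M * A ^ s := by
              gcongr
              · linarith
              · linarith
        have e2 : ((m' : ℝ) + 1) / 2 ^ n ≤ M * B ^ s := by
          have h := IH 0 m' (by omega) hm'
          have h0 : c' 0 ≥ 0 := cantorLeft_nonneg hr' n 0
          have h1 := cantorLeft_mono hr' n 0 m' (by omega) hm'
          calc ((m' : ℝ) + 1) / 2 ^ n = ((m' : ℝ) - (0 : ℕ) + 1) / 2 ^ n := by simp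
            _ ≤ _ := h
            _ ≤ M * B ^ s := by
              gcongr
              · linarith
              · linarith
        have conc : A ^ s / 2 + B ^ s / 2 ≤ ((A + B) / 2) ^ s := by
          have := (Real.concaveOn_rpow hs0.le hs1).2 (Set.mem_Ici.2 hA0) (Set.mem_Ici.2 hB0)
            (show (0 : ℝ) ≤ 1 / 2 by norm_num) (show (0 : ℝ) ≤ 1 / 2 by norm_num) (by norm_num)
          simp only [smul_eq_mul] at this
          calc _ = 1 / 2 * A ^ s + 1 / 2 * B ^ s := by ring
            _ ≤ _ := this
            _ = _ := by ring_nf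
        have hbase : (A + B) / 2 ≤ 1 - r 0 + r 0 * c' m' + r 0 * L' - r 0 * c' l := by
          have : 1 - r 0 + r 0 * c' m' + r 0 * L' - r 0 * c' l
              = 1 - 2 * r 0 + r 0 * (A + B) := by rw [hA, hB]; ring
          rw [this]
          nlinarith
        calc (((2 ^ n + m' : ℕ) : ℝ) - l + 1) / 2 ^ (n + 1)
            = (((2 : ℝ) ^ n - l) / 2 ^ n) / 2 + (((m' : ℝ) + 1) / 2 ^ n) / 2 := by
              push_cast; rw [pow_succ]; field_simp; ring
          _ ≤ (M * A ^ s) / 2 + (M * B ^ s) / 2 := by gcongr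
          _ = M * (A ^ s / 2 + B ^ s / 2) := by ring
          _ ≤ M * ((A + B) / 2) ^ s := by gcongr
          _ = M * 1 * ((A + B) / 2) ^ s := by rw [mul_one]
          _ ≤ _ := by
            gcongr
            exact le_max_left _ _
      · obtain ⟨l', rfl⟩ := Nat.exists_eq_add_of_le hl1
        have := same l' m' (by omega) hm'
        rw [cantorLeft_right_half r n l' (by omega)]
        have e : 1 - r 0 + r 0 * c' m' + r 0 * L' - (1 - r 0 + r 0 * c' l')
            = r 0 * (c' m' + L' - c' l') := by ring
        rw [e]
        push_cast
        rwa [show (2 : ℝ) ^ n + m' - (2 ^ n + l') + 1 = m' - l' + 1 by ring]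

/-! ### Sets of Cantor type -/

/-- The set of Cantor type with ratios `r`. -/
def cantorTypeSet (r : ℕ → ℝ) : Set ℝ :=
  ⋂ k : ℕ, ⋃ l ∈ Finset.range (2 ^ k), cantorInterval r k l

theorem mem_cantorTypeSet {r : ℕ → ℝ} {x : ℝ} :
    x ∈ cantorTypeSet r ↔ ∀ k, ∃ l, l < 2 ^ k ∧ x ∈ cantorInterval r k l := by
  simp [cantorTypeSet]

theorem cantorTypeSet_subset_Icc (r : ℕ → ℝ) : cantorTypeSet r ⊆ Set.Icc 0 1 := by
  intro x hx
  obtain ⟨l, hl, hx⟩ := mem_cantorTypeSet.1 hx 0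
  simpa [cantorInterval, cantorLeft, cantorLength] using hx

theorem isCompact_cantorTypeSet (r : ℕ → ℝ) : IsCompact (cantorTypeSet r) := by
  refine isCompact_Icc.of_isClosed_subset ?_ (cantorTypeSet_subset_Icc r)
  refine isClosed_iInter fun k => ?_
  exact (Finset.range (2 ^ k)).finite_toSet.isClosed_biUnion fun l _ => isClosed_Icc

theorem cantorLeft_mem_cantorTypeSet {r : ℕ → ℝ} (hr : ∀ k, 0 < r k ∧ r k < 1 / 2) {k l : ℕ}
    (hl : l < 2 ^ k) : cantorLeft r k l ∈ cantorTypeSet r := by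
  refine mem_cantorTypeSet.2 fun j => ?_
  rcases le_total j k with h | h
  · obtain ⟨i, rfl⟩ := Nat.exists_eq_add_of_le h
    refine ⟨l / 2 ^ i, ?_, cantorInterval_add_subset hr j i l (cantorLeft_mem_interval hr _ _)⟩
    rw [Nat.div_lt_iff_lt_mul (by positivity), ← pow_add]
    exact hl
  · obtain ⟨i, rfl⟩ := Nat.exists_eq_add_of_le h
    refine ⟨l * 2 ^ i, ?_, ?_⟩
    · rw [pow_add]
      gcongr
    · rw [← cantorLeft_add_mul_two_pow r k i l]
      exact cantorLeft_mem_interval hr _ _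

theorem cantorTypeSet_nonempty {r : ℕ → ℝ} (hr : ∀ k, 0 < r k ∧ r k < 1 / 2) :
    (cantorTypeSet r).Nonempty :=
  ⟨_, cantorLeft_mem_cantorTypeSet hr (k := 0) (l := 0) (by simp)⟩

theorem cantorLength_le_half_pow {r : ℕ → ℝ} (hr : ∀ k, 0 < r k ∧ r k < 1 / 2) (k : ℕ) :
    cantorLength r k ≤ (1 / 2) ^ k := by
  induction k with
  | zero => simp [cantorLength]
  | succ k ih =>
    have := two_mul_cantorLength_succ_lt hr k
    rw [pow_succ]
    linarith

theorem tendsto_cantorLength {r : ℕ → ℝ} (hr : ∀ k, 0 < r k ∧ r k < 1 / 2) :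
    Tendsto (cantorLength r) atTop (𝓝 0) :=
  squeeze_zero (fun k => (cantorLength_pos hr k).le) (cantorLength_le_half_pow hr)
    (tendsto_pow_atTop_nhds_zero_of_lt_one (by norm_num) (by norm_num))

theorem cantorTypeSet_subset_iUnion (r : ℕ → ℝ) (k : ℕ) :
    cantorTypeSet r ⊆ ⋃ l : Fin (2 ^ k), cantorInterval r k l := by
  intro x hx
  obtain ⟨l, hl, hx⟩ := mem_cantorTypeSet.1 hx k
  exact Set.mem_iUnion.2 ⟨⟨l, hl⟩, hx⟩

/-- If the total length of the generations tends to `0`, the set is null, hence has empty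
interior. -/
theorem isNowhereDense_cantorTypeSet {r : ℕ → ℝ}
    (h : Tendsto (fun k => 2 ^ k * cantorLength r k) atTop (𝓝 0)) :
    IsNowhereDense (cantorTypeSet r) := by
  have hvol : volume (cantorTypeSet r) = 0 := by
    have h1 : ∀ k, volume (cantorTypeSet r) ≤ ENNReal.ofReal (2 ^ k * cantorLength r k) := by
      intro k
      calc volume (cantorTypeSet r)
          ≤ volume (⋃ l : Fin (2 ^ k), cantorInterval r k l) :=
            measure_mono (cantorTypeSet_subset_iUnion r k)
        _ ≤ ∑ l : Fin (2 ^ k), volume (cantorInterval r k l) := measure_iUnion_fintype_le _ _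
        _ = ENNReal.ofReal (2 ^ k * cantorLength r k) := by
            simp only [cantorInterval, Real.volume_Icc, add_sub_cancel_left, Finset.sum_const,
              Finset.card_univ, Fintype.card_fin, nsmul_eq_mul]
            rw [ENNReal.ofReal_mul (by positivity), ENNReal.ofReal_pow (by norm_num)]
            simp
    have h2 := ENNReal.tendsto_ofReal h
    rw [ENNReal.ofReal_zero] at h2
    exact le_antisymm (ge_of_tendsto' h2 h1) bot_le
  exact (isCompact_cantorTypeSet r).isClosed.isNowhereDense_iff.2
    (Measure.interior_eq_empty_of_null hvol)

/-! ### The Cantor staircase and the size of sets of Cantor type -/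

/-- The Cantor staircase of the construction with ratios `r`: the increasing function which grows
by `1 / 2 ^ n` over each interval of generation `n`. It is defined for all `x` as a supremum over
the left end points to the left of `x`. -/
noncomputable def cantorStaircase (r : ℕ → ℝ) (x : ℝ) : ℝ :=
  sSup {t | ∃ n l : ℕ, l < 2 ^ n ∧ cantorLeft r n l ≤ x ∧ t = (l : ℝ) / 2 ^ n}

theorem cantorStaircase_mem_Icc {r : ℕ → ℝ} (hr : ∀ k, 0 < r k ∧ r k < 1 / 2) {n l : ℕ}
    (hl : l < 2 ^ n) {x : ℝ} (hx : x ∈ cantorInterval r n l) :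
    cantorStaircase r x ∈ Set.Icc ((l : ℝ) / 2 ^ n) ((l + 1 : ℝ) / 2 ^ n) := by
  have key : ∀ t ∈ {t | ∃ n l : ℕ, l < 2 ^ n ∧ cantorLeft r n l ≤ x ∧ t = (l : ℝ) / 2 ^ n},
      t ≤ (l + 1 : ℝ) / 2 ^ n := by
    rintro t ⟨n', l', hl', hx', rfl⟩
    by_contra! hlt
    rw [div_lt_div_iff₀ (by positivity) (by positivity)] at hlt
    have hlt' : (l + 1) * 2 ^ n' < l' * 2 ^ n := by exact_mod_cast hlt
    have hl1 : l + 1 < 2 ^ n := by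
      have h1 : (l + 1) * 2 ^ n' < 2 ^ n * 2 ^ n' :=
        hlt'.trans (by rw [mul_comm]; gcongr)
      exact lt_of_mul_lt_mul_right h1 (by positivity)
    -- compare the two end points in the common generation `n + n'`
    have h1 := cantorLeft_add_mul_two_pow r n n' (l + 1)
    have h2 := cantorLeft_add_mul_two_pow r n' n l'
    rw [add_comm n' n] at h2
    have h3 := cantorLeft_mono hr (n + n') _ _ hlt'.le (by
      rw [pow_add, mul_comm (2 ^ n)]; gcongr)
    have h4 := cantorLeft_add_lt hr n l hl1
    have := hx.2
    linarith
  refine ⟨le_csSup ⟨_, key⟩ ⟨n, l, hl, hx.1, rfl⟩, csSup_le ⟨_, n, l, hl, hx.1, rfl⟩ key⟩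

/-- The staircase is Hölder continuous of exponent `s` on the set of Cantor type. -/
theorem holderOnWith_cantorStaircase {r : ℕ → ℝ} (hr : ∀ k, 0 < r k ∧ r k < 1 / 2) {s M : ℝ≥0}
    (hs0 : 0 < s) (hs1 : s ≤ 1)
    (hM : ∀ n, ∏ j ∈ Finset.range n, max 1 (1 / (2 * r j ^ (s : ℝ))) ≤ M) :
    HolderOnWith M s (cantorStaircase r) (cantorTypeSet r) := by
  have key : ∀ x ∈ cantorTypeSet r, ∀ y ∈ cantorTypeSet r, x ≤ y →
      cantorStaircase r y - cantorStaircase r x ≤ M * (y - x) ^ (s : ℝ) := by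
    intro x hx y hy hxy
    have h1 : ∀ n, cantorStaircase r y - cantorStaircase r x
        ≤ M * (y - x + 2 * cantorLength r n) ^ (s : ℝ) := by
      intro n
      obtain ⟨l, hl, hxl⟩ := mem_cantorTypeSet.1 hx n
      obtain ⟨m, hm, hym⟩ := mem_cantorTypeSet.1 hy n
      have hL := cantorLength_pos hr n
      have h2 := (cantorStaircase_mem_Icc hr hl hxl).1
      have h3 := (cantorStaircase_mem_Icc hr hm hym).2
      have h4 : cantorStaircase r y - cantorStaircase r x ≤ ((m : ℝ) - l + 1) / 2 ^ n := by
        calc _ ≤ (m + 1 : ℝ) / 2 ^ n - (l : ℝ) / 2 ^ n := by linarith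
          _ = _ := by ring
      rcases le_or_gt l m with hlm | hlm
      · have h5 := card_div_two_pow_le_hull_rpow (s := s) (by exact_mod_cast hs0)
          (by exact_mod_cast hs1) n r hr l m hlm hm
        have h6 := cantorLeft_mono hr n l m hlm hm
        refine (h4.trans h5).trans ?_
        have h7 : 0 ≤ cantorLeft r n m + cantorLength r n - cantorLeft r n l := by linarith
        gcongr
        · exact hM n
        · linarith [hym.1, hxl.2]
      · refine h4.trans (le_trans ?_ (mul_nonneg M.coe_nonneg (Real.rpow_nonneg (by linarith) _)))
        refine div_nonpos_of_nonpos_of_nonneg ?_ (by positivity)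
        have : (m : ℝ) + 1 ≤ l := by exact_mod_cast hlm
        linarith
    have h2 : Tendsto (fun n => (M : ℝ) * (y - x + 2 * cantorLength r n) ^ (s : ℝ)) atTop
        (𝓝 (M * (y - x + 2 * 0) ^ (s : ℝ))) :=
      (((tendsto_cantorLength hr).const_mul 2).const_add (y - x)).rpow_const
        (Or.inr s.coe_nonneg) |>.const_mul _
    rw [mul_zero, add_zero] at h2
    exact ge_of_tendsto' h2 h1
  have mono : ∀ x ∈ cantorTypeSet r, ∀ y : ℝ, x ≤ y →
      cantorStaircase r x ≤ cantorStaircase r y := by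
    intro x hx y hxy
    refine csSup_le_csSup ⟨1, ?_⟩ ⟨0, 0, 0, by simp, (cantorTypeSet_subset_Icc r hx).1, by simp⟩ ?_
    · rintro t ⟨n, l, hl, -, rfl⟩
      rw [div_le_one (by positivity)]
      exact_mod_cast hl.le
    · rintro t ⟨n, l, hl, hlx, rfl⟩
      exact ⟨n, l, hl, hlx.trans hxy, rfl⟩
  have ordered : ∀ x ∈ cantorTypeSet r, ∀ y ∈ cantorTypeSet r, x ≤ y →
      edist (cantorStaircase r x) (cantorStaircase r y) ≤ M * edist x y ^ (s : ℝ) := by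
    intro x hx y hy hxy
    rw [edist_comm, edist_comm x, edist_dist, edist_dist, Real.dist_eq, Real.dist_eq,
      abs_of_nonneg (sub_nonneg.2 (mono x hx y hxy)), abs_of_nonneg (sub_nonneg.2 hxy),
      ENNReal.ofReal_rpow_of_nonneg (sub_nonneg.2 hxy) s.coe_nonneg, ← ENNReal.ofReal_coe_nnreal,
      ← ENNReal.ofReal_mul M.coe_nonneg]
    exact ENNReal.ofReal_le_ofReal (key x hx y hy hxy)
  intro x hx y hy
  rcases le_total x y with h | h
  · exact ordered x hx y hy h
  · rw [edist_comm, edist_comm x]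
    exact ordered y hy x hx h

theorem Ico_subset_image_cantorStaircase {r : ℕ → ℝ} (hr : ∀ k, 0 < r k ∧ r k < 1 / 2) :
    Set.Ico 0 1 ⊆ cantorStaircase r '' cantorTypeSet r := by
  rintro t ⟨ht0, ht1⟩
  -- the interval of generation `n` over which the staircase takes the value `t`
  set d : ℕ → ℕ := fun n => ⌊t * 2 ^ n⌋₊ with hd
  have hd1 : ∀ n, d n < 2 ^ n := by
    intro n
    rw [hd, Nat.floor_lt (by positivity)]
    push_cast
    nlinarith [show (0 : ℝ) < 2 ^ n by positivity]
  have hd2 : ∀ n, d (n + 1) / 2 = d n := by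
    intro n
    have := Nat.floor_div_natCast (t * 2 ^ (n + 1)) 2
    rw [hd]
    dsimp only
    rw [← this]
    congr 1
    rw [pow_succ]
    push_cast
    ring
  obtain ⟨x, hx⟩ := IsCompact.nonempty_iInter_of_sequence_nonempty_isCompact_isClosed
    (fun n => cantorInterval r n (d n))
    (fun n => by
      have := cantorInterval_succ_subset hr n (d (n + 1))
      rwa [hd2 n] at this)
    (fun n => ⟨_, cantorLeft_mem_interval hr n (d n)⟩) isCompact_Icc (fun n => isClosed_Icc)
  rw [Set.mem_iInter] at hx
  refine ⟨x, mem_cantorTypeSet.2 fun k => ⟨d k, hd1 k, hx k⟩, ?_⟩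
  have h1 : ∀ n : ℕ, |cantorStaircase r x - t| ≤ (1 / 2) ^ n := by
    intro n
    have h2 := cantorStaircase_mem_Icc hr (hd1 n) (hx n)
    have hp : (0 : ℝ) < 2 ^ n := by positivity
    have h3 : (d n : ℝ) / 2 ^ n ≤ t := by
      rw [div_le_iff₀ hp]
      exact Nat.floor_le (by positivity)
    have h4 : t ≤ (d n + 1 : ℝ) / 2 ^ n := by
      rw [le_div_iff₀ hp]
      exact (Nat.lt_floor_add_one _).le
    have h5 : (d n + 1 : ℝ) / 2 ^ n = (d n : ℝ) / 2 ^ n + (1 / 2) ^ n := by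
      rw [add_div, one_div_pow]
    rw [abs_le]
    constructor <;> linarith [h2.1, h2.2]
  have h2 := ge_of_tendsto' (tendsto_pow_atTop_nhds_zero_of_lt_one (by norm_num)
    (by norm_num : (1 / 2 : ℝ) < 1)) h1
  exact sub_eq_zero.1 (abs_nonpos_iff.1 h2)

/-- With constant ratio `r`, where `2 * r ^ s = 1`, the set of Cantor type has `s`-dimensional
Hausdorff measure `1`: the intervals of each generation cover it with `s`-mass `1`, and the
staircase maps it onto an interval of length `1` with Hölder constant `1`. -/
theorem hausdorffMeasure_cantorTypeSet {r : ℕ → ℝ} (hr : ∀ k, 0 < r k ∧ r k < 1 / 2) {s : ℝ}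
    (hs0 : 0 < s) (hs1 : s ≤ 1) (hrs : ∀ k, r k ^ s = 1 / 2) :
    Measure.hausdorffMeasure s (cantorTypeSet r) = 1 := by
  lift s to ℝ≥0 using hs0.le
  have hL : ∀ k, cantorLength r k ^ (s : ℝ) = (1 / 2) ^ k := by
    intro k
    induction k with
    | zero => simp [cantorLength]
    | succ k ih =>
      rw [cantorLength_succ, Real.mul_rpow (cantorLength_pos hr k).le (hr k).1.le, ih, hrs,
        pow_succ]
  have hdiam : ∀ k l, Metric.ediam (cantorInterval r k l) = ENNReal.ofReal (cantorLength r k) := by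
    intro k l
    rw [cantorInterval, Real.ediam_Icc, add_sub_cancel_left]
  apply le_antisymm
  · have h := Measure.hausdorffMeasure_le_liminf_sum (ι := fun k : ℕ => Fin (2 ^ k)) s
      (cantorTypeSet r) (l := atTop) (fun k => ENNReal.ofReal (cantorLength r k))
      (by
        have := ENNReal.tendsto_ofReal (tendsto_cantorLength hr)
        rwa [ENNReal.ofReal_zero] at this)
      (fun k l => cantorInterval r k l)
      (Eventually.of_forall fun k l => (hdiam k l).le)
      (Eventually.of_forall fun k => cantorTypeSet_subset_iUnion r k)
    have h2 : ∀ k : ℕ, ∑ l : Fin (2 ^ k), Metric.ediam (cantorInterval r k l) ^ (s : ℝ) = 1 := by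
      intro k
      simp only [hdiam, Finset.sum_const, Finset.card_univ, Fintype.card_fin, nsmul_eq_mul]
      rw [ENNReal.ofReal_rpow_of_pos (cantorLength_pos hr k), hL,
        ← ENNReal.ofReal_natCast, ← ENNReal.ofReal_mul (by positivity)]
      push_cast
      rw [← mul_pow]
      norm_num
    simpa only [h2, liminf_const] using h
  · have h := holderOnWith_cantorStaircase hr (s := s) (M := 1) (by exact_mod_cast hs0)
      (by exact_mod_cast hs1) (by
      intro n
      refine (Finset.prod_eq_one fun j _ => ?_).le
      rw [hrs]
      norm_num)
    have h2 := h.hausdorffMeasure_image_le (by exact_mod_cast hs0) (d := 1) zero_le_one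
    rw [hausdorffMeasure_real] at h2
    have h3 := measure_mono (μ := volume) (Ico_subset_image_cantorStaircase hr)
    rw [Real.volume_Ico] at h3
    simpa using h3.trans h2

/-- If the ratios tend to `1 / 2`, the set of Cantor type has Hausdorff dimension `1`: for each
`s < 1` only finitely many ratios violate `1 ≤ 2 * r j ^ s`, so the staircase is `s`-Hölder. -/
theorem dimH_cantorTypeSet_eq_one {r : ℕ → ℝ} (hr : ∀ k, 0 < r k ∧ r k < 1 / 2)
    (hlim : Tendsto r atTop (𝓝 (1 / 2))) : dimH (cantorTypeSet r) = 1 := by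
  apply le_antisymm
  · exact (dimH_mono (Set.subset_univ _)).trans Real.dimH_univ.le
  · refine le_of_forall_lt fun a ha => ?_
    lift a to ℝ≥0 using ha.ne_top
    have ha1 : a < 1 := by exact_mod_cast ha
    obtain ⟨s, has, hs1⟩ := exists_between ha1
    have hs0 : 0 < s := zero_le.trans_lt has
    have hev : ∀ᶠ j in atTop, 1 / (2 * r j ^ (s : ℝ)) ≤ 1 := by
      have h1 : Tendsto (fun j => r j ^ (s : ℝ)) atTop (𝓝 ((1 / 2) ^ (s : ℝ))) :=
        hlim.rpow_const (Or.inr s.coe_nonneg)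
      have h2 : (1 / 2 : ℝ) < (1 / 2) ^ (s : ℝ) := by
        have := Real.rpow_lt_rpow_of_exponent_gt (x := 1 / 2) (y := 1) (z := s)
          (by norm_num) (by norm_num) (by exact_mod_cast hs1)
        rwa [Real.rpow_one] at this
      filter_upwards [h1.eventually_const_lt h2] with j hj
      rw [div_le_one (by linarith)]
      linarith
    obtain ⟨N, hN⟩ := eventually_atTop.1 hev
    set P : ℕ → ℝ := fun n => ∏ j ∈ Finset.range n, max 1 (1 / (2 * r j ^ (s : ℝ))) with hP
    have hPmono : Monotone P := by
      refine monotone_nat_of_le_succ fun n => ?_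
      rw [hP]
      dsimp only
      rw [Finset.prod_range_succ]
      exact le_mul_of_one_le_right
        (Finset.prod_nonneg fun j _ => zero_le_one.trans (le_max_left _ _)) (le_max_left _ _)
    have hPN : ∀ n, P n ≤ P N := by
      intro n
      rcases le_total n N with h | h
      · exact hPmono h
      · induction n, h using Nat.le_induction with
        | base => exact le_rfl
        | succ n hn ih =>
          have : P (n + 1) = P n := by
            rw [hP]
            dsimp only
            rw [Finset.prod_range_succ, max_eq_left (hN n hn), mul_one]
          rw [this]
          exact ih
    have h := holderOnWith_cantorStaircase hr (s := s) (M := (P N).toNNReal) hs0 hs1.le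
      (fun n => (hPN n).trans (Real.le_coe_toNNReal _))
    have h2 := h.dimH_image_le hs0
    have h3 : dimH (Set.Ico (0 : ℝ) 1) = 1 := by
      rw [Real.dimH_of_nonempty_interior (by simp)]
      simp
    have h4 := (h3.symm.le.trans (dimH_mono (Ico_subset_image_cantorStaircase hr))).trans h2
    rw [ENNReal.le_div_iff_mul_le (by simp [hs0.ne']) (by simp), one_mul] at h4
    exact lt_of_lt_of_le (by exact_mod_cast has) h4

/-! ### Tempered functions off a compact set and their flat extensions -/

/-- `Q` is holomorphic off `K` and, at distance at least `L k` from `K`, it is bounded by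
`C * exp (η * (k + 1) ^ 3)` for arbitrarily small `η`. With `L k` decaying exponentially, this
says that `|Q|` is at most `exp (o (log ^ 3 (1 / dist)))`. -/
def IsTempered (L : ℕ → ℝ) (K : Set ℂ) (Q : ℂ → ℂ) : Prop :=
  DifferentiableOn ℂ Q Kᶜ ∧ ∀ η : ℝ, 0 < η → ∃ C : ℝ, ∀ (k : ℕ) (z : ℂ),
    L k ≤ Metric.infDist z K → ‖Q z‖ ≤ C * Real.exp (η * (k + 1) ^ 3)

theorem exists_mul_sq_le_add_mul_cube (c : ℝ) {η : ℝ} (hη : 0 < η) :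
    ∃ C : ℝ, ∀ k : ℕ, c * ((k : ℝ) + 1) ^ 2 ≤ C + η * ((k : ℝ) + 1) ^ 3 := by
  refine ⟨|c| * (|c| / η) ^ 2, fun k => ?_⟩
  have hx : (0 : ℝ) < (k : ℝ) + 1 := by positivity
  have h1 : c * ((k : ℝ) + 1) ^ 2 ≤ |c| * ((k : ℝ) + 1) ^ 2 := by
    gcongr
    exact le_abs_self c
  refine h1.trans ?_
  rcases le_total (|c| / η) ((k : ℝ) + 1) with h | h
  · have h2 : |c| ≤ η * ((k : ℝ) + 1) := by rwa [div_le_iff₀' hη] at h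
    have h3 : |c| * ((k : ℝ) + 1) ^ 2 ≤ η * ((k : ℝ) + 1) * ((k : ℝ) + 1) ^ 2 := by gcongr
    have h4 : 0 ≤ |c| * (|c| / η) ^ 2 := by positivity
    nlinarith
  · have h3 : |c| * ((k : ℝ) + 1) ^ 2 ≤ |c| * (|c| / η) ^ 2 := by gcongr
    have h4 : 0 ≤ η * ((k : ℝ) + 1) ^ 3 := by positivity
    linarith

/-- A bound of order `exp (O (k ^ 2))` suffices for temperedness. -/
theorem isTempered_of_le_exp_sq {L : ℕ → ℝ} {K : Set ℂ} {Q : ℂ → ℂ}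
    (hQ : DifferentiableOn ℂ Q Kᶜ) {A c : ℝ} (hA : 0 ≤ A)
    (h : ∀ (k : ℕ) (z : ℂ), L k ≤ Metric.infDist z K →
      ‖Q z‖ ≤ A * Real.exp (c * ((k : ℝ) + 1) ^ 2)) : IsTempered L K Q := by
  refine ⟨hQ, fun η hη => ?_⟩
  obtain ⟨C, hC⟩ := exists_mul_sq_le_add_mul_cube c hη
  refine ⟨A * Real.exp C, fun k z hz => (h k z hz).trans ?_⟩
  rw [mul_assoc, ← Real.exp_add]
  gcongr
  exact hC k

namespace IsTempered

variable {L : ℕ → ℝ} {K : Set ℂ} {Q R : ℂ → ℂ}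

theorem const (c : ℂ) : IsTempered L K fun _ => c :=
  isTempered_of_le_exp_sq (differentiableOn_const c) (norm_nonneg c) (c := 0) (by simp)

theorem sub (hQ : IsTempered L K Q) (hR : IsTempered L K R) :
    IsTempered L K fun z => Q z - R z := by
  refine ⟨hQ.1.sub hR.1, fun η hη => ?_⟩
  obtain ⟨C, hC⟩ := hQ.2 η hη
  obtain ⟨D, hD⟩ := hR.2 η hη
  refine ⟨C + D, fun k z hz => (norm_sub_le _ _).trans ?_⟩
  rw [add_mul]
  exact add_le_add (hC k z hz) (hD k z hz)

theorem mul (hQ : IsTempered L K Q) (hR : IsTempered L K R) :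
    IsTempered L K fun z => Q z * R z := by
  refine ⟨hQ.1.mul hR.1, fun η hη => ?_⟩
  obtain ⟨C, hC⟩ := hQ.2 (η / 2) (half_pos hη)
  obtain ⟨D, hD⟩ := hR.2 (η / 2) (half_pos hη)
  refine ⟨C * D, fun k z hz => ?_⟩
  rw [norm_mul]
  calc ‖Q z‖ * ‖R z‖ ≤ (C * Real.exp (η / 2 * (k + 1) ^ 3)) *
        (D * Real.exp (η / 2 * (k + 1) ^ 3)) :=
        mul_le_mul (hC k z hz) (hD k z hz) (norm_nonneg _) ((norm_nonneg _).trans (hC k z hz))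
    _ = C * D * (Real.exp (η / 2 * (k + 1) ^ 3) * Real.exp (η / 2 * (k + 1) ^ 3)) := by ring
    _ = C * D * Real.exp (η * (k + 1) ^ 3) := by
        rw [← Real.exp_add]
        ring_nf

/-- Cauchy's estimate on a disc of radius `L (k + 1)`: derivatives of tempered functions are
tempered. -/
theorem deriv (hK : IsClosed K) (hL0 : ∀ k, 0 < L k) (hL2 : ∀ k, 2 * L (k + 1) ≤ L k) {b : ℝ}
    (hLb : ∀ k : ℕ, Real.exp (-(b * (k + 1))) ≤ L k) (hQ : IsTempered L K Q) :
    IsTempered L K (deriv Q) := by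
  refine ⟨hQ.1.deriv hK.isOpen_compl, fun η hη => ?_⟩
  obtain ⟨C, hC⟩ := hQ.2 (η / 16) (by positivity)
  obtain ⟨D, hD⟩ := exists_mul_sq_le_add_mul_cube (2 * |b|) (half_pos hη)
  refine ⟨C * Real.exp D, fun k z hz => ?_⟩
  have hk : (0 : ℝ) ≤ k := k.cast_nonneg
  have hnear : ∀ w ∈ Metric.closedBall z (L (k + 1)), L (k + 1) ≤ Metric.infDist w K := by
    intro w hw
    have h1 := Metric.infDist_le_infDist_add_dist (s := K) (x := z) (y := w)
    rw [Metric.mem_closedBall, dist_comm] at hw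
    linarith [hL2 k]
  have hsub : Metric.closedBall z (L (k + 1)) ⊆ Kᶜ := by
    intro w hw hwK
    have h1 := hnear w hw
    rw [Metric.infDist_zero_of_mem hwK] at h1
    exact absurd h1 (not_le.2 (hL0 _))
  have hd : DiffContOnCl ℂ Q (Metric.ball z (L (k + 1))) := by
    refine DifferentiableOn.diffContOnCl ?_
    rw [closure_ball _ (hL0 _).ne']
    exact hQ.1.mono hsub
  have hcauchy := Complex.norm_deriv_le_of_forall_mem_sphere_norm_le (hL0 (k + 1)) hd
    (fun w hw => hC (k + 1) w (hnear w (Metric.sphere_subset_closedBall hw)))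
  have hC0 : 0 ≤ C := by
    have := (norm_nonneg _).trans
      (hC (k + 1) z (hnear z (Metric.mem_closedBall_self (hL0 _).le)))
    exact nonneg_of_mul_nonneg_left this (Real.exp_pos _)
  have hinv : (L (k + 1))⁻¹ ≤ Real.exp (2 * |b| * (k + 1) ^ 2) := by
    rw [inv_le_comm₀ (hL0 _) (Real.exp_pos _), ← Real.exp_neg]
    refine le_trans ?_ (hLb (k + 1))
    rw [Real.exp_le_exp, neg_le_neg_iff]
    push_cast
    calc b * (k + 1 + 1 : ℝ) ≤ |b| * (k + 1 + 1) := by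
          gcongr
          exact le_abs_self b
      _ ≤ |b| * (2 * (k + 1) ^ 2) := by
          gcongr
          nlinarith
      _ = _ := by ring
  have hexp : η / 16 * ((k + 1 : ℕ) + 1 : ℝ) ^ 3 ≤ η / 2 * (k + 1) ^ 3 := by
    have h1 : ((k + 1 : ℕ) + 1 : ℝ) ^ 3 ≤ (2 * (k + 1 : ℝ)) ^ 3 := by
      push_cast
      gcongr
      linarith
    calc _ ≤ η / 16 * (2 * (k + 1 : ℝ)) ^ 3 := by gcongr
      _ = _ := by ring
  calc ‖_root_.deriv Q z‖
      ≤ C * Real.exp (η / 16 * ((k + 1 : ℕ) + 1 : ℝ) ^ 3) / L (k + 1) := hcauchy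
    _ = C * Real.exp (η / 16 * ((k + 1 : ℕ) + 1 : ℝ) ^ 3) * (L (k + 1))⁻¹ := div_eq_mul_inv _ _
    _ ≤ C * Real.exp (η / 2 * (k + 1) ^ 3) * Real.exp (D + η / 2 * (k + 1) ^ 3) := by
        have hLpos := hL0 (k + 1)
        gcongr
        exact hinv.trans (Real.exp_le_exp.2 (hD k))
    _ = C * Real.exp D * Real.exp (η * (k + 1) ^ 3) := by
        rw [mul_assoc, mul_assoc, ← Real.exp_add, ← Real.exp_add]
        ring_nf

end IsTempered

/-- `Q * exp (-F)`, extended by `0` to `K`. -/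
noncomputable def flatExtension (K : Set ℂ) (F Q : ℂ → ℂ) : ℂ → ℂ :=
  Kᶜ.indicator fun z => Q z * Complex.exp (-F z)

theorem flatExtension_of_mem {K : Set ℂ} {F Q : ℂ → ℂ} {z : ℂ} (hz : z ∈ K) :
    flatExtension K F Q z = 0 := by
  simp [flatExtension, hz]

theorem flatExtension_of_notMem {K : Set ℂ} {F Q : ℂ → ℂ} {z : ℂ} (hz : z ∉ K) :
    flatExtension K F Q z = Q z * Complex.exp (-F z) := by
  simp [flatExtension, hz]

theorem uniqueDiffOn_closedRightHalfPlane : UniqueDiffOn ℝ closedRightHalfPlane := by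
  refine uniqueDiffOn_convex (convex_halfSpace_re_ge 0) ⟨1, ?_⟩
  refine mem_interior.2 ⟨{z | 0 < z.re}, fun z hz => le_of_lt (show 0 < z.re from hz),
    isOpen_lt continuous_const Complex.continuous_re, ?_⟩
  simp

/-- The growth of `Re F` at `K` beats every tempered function and any power of the distance. -/
theorem exists_norm_flatExtension_le {L : ℕ → ℝ} {K : Set ℂ} {F Q : ℂ → ℂ}
    (hKc : IsClosed K) (hKne : K.Nonempty)
    (hLlim : Tendsto L atTop (𝓝 0)) {b : ℝ}
    (hLb : ∀ k : ℕ, Real.exp (-(b * (k + 1))) ≤ L k) {c : ℝ} (hc : 0 < c)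
    (hF : ∀ (k : ℕ), ∀ z ∈ closedRightHalfPlane, z ∉ K → Metric.infDist z K ≤ L k →
      c * ((k : ℝ) + 1) ^ 3 ≤ (F z).re)
    (hQ : IsTempered L K Q) :
    ∃ C : ℝ, ∀ z ∈ closedRightHalfPlane, Metric.infDist z K ≤ L 0 →
      ‖flatExtension K F Q z‖ ≤ C * Metric.infDist z K ^ 2 := by
  obtain ⟨C, hC⟩ := hQ.2 (c / 16) (by positivity)
  obtain ⟨D, hD⟩ := exists_mul_sq_le_add_mul_cube (4 * |b|) (half_pos hc)
  refine ⟨|C| * Real.exp D, fun z hz hz0 => ?_⟩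
  by_cases hzK : z ∈ K
  · rw [flatExtension_of_mem hzK, norm_zero]
    positivity
  have hd : 0 < Metric.infDist z K := (hKc.notMem_iff_infDist_pos hKne).1 hzK
  -- the generation `k` with `L (k + 1) ≤ infDist z K ≤ L k`
  obtain ⟨k, hk1, hk2⟩ : ∃ k, L (k + 1) ≤ Metric.infDist z K ∧ Metric.infDist z K ≤ L k := by
    by_contra! hcon
    have hall : ∀ k, Metric.infDist z K ≤ L k := by
      intro k
      induction k with
      | zero => exact hz0
      | succ k ih =>
        by_contra hlt
        exact absurd ih (not_le.2 (hcon k (not_le.1 hlt).le))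
    exact absurd (ge_of_tendsto' hLlim hall) (not_le.2 hd)
  have hk : (0 : ℝ) ≤ k := k.cast_nonneg
  have h1 := hC (k + 1) z hk1
  have h2 := hF k z hz hzK hk2
  have h3 : (1 : ℝ) ≤ Real.exp (4 * |b| * (k + 1) ^ 2) * Metric.infDist z K ^ 2 := by
    have h4 : Real.exp (-(2 * |b| * (k + 1) ^ 2)) ≤ Metric.infDist z K := by
      refine le_trans ?_ ((hLb (k + 1)).trans hk1)
      rw [Real.exp_le_exp, neg_le_neg_iff]
      push_cast
      calc b * (k + 1 + 1 : ℝ) ≤ |b| * (k + 1 + 1) := by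
            gcongr
            exact le_abs_self b
        _ ≤ |b| * (2 * (k + 1) ^ 2) := by
            gcongr
            nlinarith
        _ = _ := by ring
    calc (1 : ℝ) = Real.exp (4 * |b| * (k + 1) ^ 2) * Real.exp (-(2 * |b| * (k + 1) ^ 2)) ^ 2 := by
          rw [← Real.exp_nat_mul, ← Real.exp_add, ← Real.exp_zero]
          congr 1
          push_cast
          ring
      _ ≤ _ := by gcongr
  have hexp : c / 16 * ((k + 1 : ℕ) + 1 : ℝ) ^ 3 ≤ c / 2 * (k + 1) ^ 3 := by
    have h1 : ((k + 1 : ℕ) + 1 : ℝ) ^ 3 ≤ (2 * (k + 1 : ℝ)) ^ 3 := by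
      push_cast
      gcongr
      linarith
    calc _ ≤ c / 16 * (2 * (k + 1 : ℝ)) ^ 3 := by gcongr
      _ = _ := by ring
  rw [flatExtension_of_notMem hzK, norm_mul, Complex.norm_exp, Complex.neg_re]
  calc ‖Q z‖ * Real.exp (-(F z).re)
      ≤ (|C| * Real.exp (c / 2 * (k + 1) ^ 3)) * Real.exp (-(c * (k + 1) ^ 3)) := by
        gcongr
        refine h1.trans ?_
        gcongr
        exact le_abs_self C
    _ = |C| * Real.exp (-(c / 2 * (k + 1) ^ 3)) * 1 := by
        rw [mul_assoc, ← Real.exp_add]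
        ring_nf
    _ ≤ |C| * Real.exp (-(c / 2 * (k + 1) ^ 3)) *
          (Real.exp (4 * |b| * (k + 1) ^ 2) * Metric.infDist z K ^ 2) := by gcongr
    _ ≤ |C| * Real.exp (-(c / 2 * (k + 1) ^ 3)) *
          (Real.exp (D + c / 2 * (k + 1) ^ 3) * Metric.infDist z K ^ 2) := by
        gcongr
        exact hD k
    _ = |C| * (Real.exp (-(c / 2 * (k + 1) ^ 3)) * Real.exp (D + c / 2 * (k + 1) ^ 3)) *
          Metric.infDist z K ^ 2 := by ring
    _ = |C| * Real.exp D * Metric.infDist z K ^ 2 := by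
        rw [← Real.exp_add]
        ring_nf

/-- The flat extension is complex differentiable up to the boundary of the half plane, and its
derivative is again a flat extension. At points of `K` this holds because the flat extension is
bounded by the square of the distance. -/
theorem hasDerivWithinAt_flatExtension {L : ℕ → ℝ} {K : Set ℂ} {F Q : ℂ → ℂ}
    (hKc : IsClosed K) (hKne : K.Nonempty)
    (hL0 : ∀ k, 0 < L k) (hLlim : Tendsto L atTop (𝓝 0)) {b : ℝ}
    (hLb : ∀ k : ℕ, Real.exp (-(b * (k + 1))) ≤ L k) {c : ℝ} (hc : 0 < c)
    (hF : ∀ (k : ℕ), ∀ z ∈ closedRightHalfPlane, z ∉ K → Metric.infDist z K ≤ L k →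
      c * ((k : ℝ) + 1) ^ 3 ≤ (F z).re)
    (hFd : DifferentiableOn ℂ F Kᶜ) (hQ : IsTempered L K Q) (z : ℂ) :
    HasDerivWithinAt (flatExtension K F Q)
      (flatExtension K F (fun z => deriv Q z - Q z * deriv F z) z) closedRightHalfPlane z := by
  by_cases hzK : z ∈ K
  · rw [flatExtension_of_mem hzK, hasDerivWithinAt_iff_isLittleO, flatExtension_of_mem hzK]
    obtain ⟨C, hC⟩ := exists_norm_flatExtension_le hKc hKne hLlim hLb hc hF hQ
    have hO : (fun w => flatExtension K F Q w) =O[𝓝[closedRightHalfPlane] z]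
        fun w => ‖w - z‖ ^ 2 := by
      refine Asymptotics.IsBigO.of_bound |C| ?_
      have hball : Metric.ball z (L 0) ∈ 𝓝[closedRightHalfPlane] z :=
        mem_nhdsWithin_of_mem_nhds (Metric.ball_mem_nhds z (hL0 0))
      filter_upwards [hball, self_mem_nhdsWithin] with w hw hwS
      have h1 : Metric.infDist w K ≤ ‖w - z‖ := by
        rw [← dist_eq_norm]
        exact Metric.infDist_le_dist_of_mem hzK
      have h2 : ‖w - z‖ ≤ L 0 := by
        rw [← dist_eq_norm]
        exact (Metric.mem_ball.1 hw).le
      refine (hC w hwS (h1.trans h2)).trans ?_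
      rw [norm_pow, norm_norm]
      have := Metric.infDist_nonneg (x := w) (s := K)
      gcongr
      exact le_abs_self C
    have ho : (fun w => ‖w - z‖ ^ 2) =o[𝓝[closedRightHalfPlane] z] fun w => w - z := by
      have h1 : Tendsto (fun w => w - z) (𝓝[closedRightHalfPlane] z) (𝓝 0) := by
        have : Tendsto (fun w : ℂ => w - z) (𝓝 z) (𝓝 (z - z)) :=
          (continuous_id.sub continuous_const).tendsto z
        rw [sub_self] at this
        exact this.mono_left nhdsWithin_le_nhds
      have h2 := (Asymptotics.isLittleO_norm_pow_id (E' := ℂ) one_lt_two).comp_tendsto h1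
      exact h2
    simpa using hO.trans_isLittleO ho
  · have hopen : Kᶜ ∈ 𝓝 z := hKc.isOpen_compl.mem_nhds hzK
    have h1 : HasDerivAt Q (deriv Q z) z := (hQ.1.differentiableAt hopen).hasDerivAt
    have h2 : HasDerivAt F (deriv F z) z := (hFd.differentiableAt hopen).hasDerivAt
    have h3 := h1.mul h2.neg.cexp
    have h4 : flatExtension K F Q =ᶠ[𝓝 z] fun z => Q z * Complex.exp (-F z) := by
      filter_upwards [hopen] with w hw
      exact flatExtension_of_notMem hw
    rw [flatExtension_of_notMem hzK]
    refine HasDerivAt.hasDerivWithinAt (HasDerivAt.congr_of_eventuallyEq ?_ h4)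
    convert! h3 using 1
    simp only [Pi.neg_apply]
    ring

/-- Flat extensions of tempered functions are smooth on the closed half plane and vanish to
infinite order on `K`. -/
theorem contDiffOn_flatExtension {L : ℕ → ℝ} {K : Set ℂ} {F : ℂ → ℂ}
    (hKc : IsClosed K) (hKne : K.Nonempty)
    (hL0 : ∀ k, 0 < L k) (hL2 : ∀ k, 2 * L (k + 1) ≤ L k) (hLlim : Tendsto L atTop (𝓝 0)) {b : ℝ}
    (hLb : ∀ k : ℕ, Real.exp (-(b * (k + 1))) ≤ L k) {c : ℝ} (hc : 0 < c)
    (hF : ∀ (k : ℕ), ∀ z ∈ closedRightHalfPlane, z ∉ K → Metric.infDist z K ≤ L k →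
      c * ((k : ℝ) + 1) ^ 3 ≤ (F z).re)
    (hFt : IsTempered L K F) {Q : ℂ → ℂ} (hQ : IsTempered L K Q) :
    ContDiffOn ℝ ((⊤ : ℕ∞) : WithTop ℕ∞) (flatExtension K F Q) closedRightHalfPlane ∧
      ∀ p ∈ K, p ∈ closedRightHalfPlane →
        VanishesToInfiniteOrderAt (flatExtension K F Q) p := by
  -- the real derivative of a function with complex derivative `a` is `T a`
  set T : ℂ →L[ℝ] (ℂ →L[ℝ] ℂ) := ContinuousLinearMap.mul ℝ ℂ with hT
  have hD : ∀ {Q : ℂ → ℂ}, IsTempered L K Q → ∀ z ∈ closedRightHalfPlane,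
      HasFDerivWithinAt (flatExtension K F Q)
        (T (flatExtension K F (fun z => deriv Q z - Q z * deriv F z) z))
        closedRightHalfPlane z := by
    intro Q hQ z hz
    have h1 := (hasDerivWithinAt_flatExtension hKc hKne hL0 hLlim hLb hc hF hFt.1 hQ
      z).hasFDerivWithinAt.restrictScalars ℝ
    convert! h1 using 1
    ext w
    simp [hT, mul_comm]
  have hQ' : ∀ {Q : ℂ → ℂ}, IsTempered L K Q →
      IsTempered L K (fun z => deriv Q z - Q z * deriv F z) := fun hQ =>
    (hQ.deriv hKc hL0 hL2 hLb).sub (hQ.mul (hFt.deriv hKc hL0 hL2 hLb))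
  have hsm : ∀ n : ℕ, ∀ {Q : ℂ → ℂ}, IsTempered L K Q →
      ContDiffOn ℝ n (flatExtension K F Q) closedRightHalfPlane := by
    intro n
    induction n with
    | zero =>
      intro Q hQ
      exact contDiffOn_zero.2 fun z hz => (hD hQ z hz).continuousWithinAt
    | succ n ih =>
      intro Q hQ
      push_cast
      refine (contDiffOn_succ_iff_fderivWithin uniqueDiffOn_closedRightHalfPlane).2
        ⟨fun z hz => (hD hQ z hz).differentiableWithinAt, by simp, ?_⟩
      refine (T.contDiff.comp_contDiffOn (ih (hQ' hQ))).congr fun z hz => ?_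
      exact (hD hQ z hz).fderivWithin (uniqueDiffOn_closedRightHalfPlane z hz)
  refine ⟨contDiffOn_infty.2 fun n => hsm n hQ, fun p hpK hp m => ?_⟩
  induction m generalizing Q with
  | zero =>
    ext
    simp [flatExtension_of_mem hpK]
  | succ m ih =>
    have h1 : iteratedFDerivWithin ℝ m (fderivWithin ℝ (flatExtension K F Q) closedRightHalfPlane)
        closedRightHalfPlane p = 0 := by
      rw [iteratedFDerivWithin_congr (f := T ∘ flatExtension K F
        (fun z => deriv Q z - Q z * deriv F z)) (fun z hz => (hD hQ z hz).fderivWithin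
          (uniqueDiffOn_closedRightHalfPlane z hz)) hp,
        T.iteratedFDerivWithin_comp_left (hsm m (hQ' hQ) p hp) uniqueDiffOn_closedRightHalfPlane hp
          le_rfl, ih (hQ' hQ)]
      ext
      simp
    ext v
    rw [iteratedFDerivWithin_succ_apply_right uniqueDiffOn_closedRightHalfPlane hp]
    exact congrArg (fun A => A (Fin.init v) (v (Fin.last m))) h1

/-! ### The singular set -/

/-- The set `{-t - i y : y ∈ E, 0 ≤ t ≤ 1}`. It contains `-i E` and the poles of the functions
used below. As it lies in the closed left half plane, the distance to it from a point of the closed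
right half plane is the distance to `-i E`. -/
def leftShadow (E : Set ℝ) : Set ℂ :=
  (fun p : ℝ × ℝ => -(Complex.I * p.1 + p.2)) '' (E ×ˢ Set.Icc (0 : ℝ) 1)

theorem isCompact_leftShadow {E : Set ℝ} (hE : IsCompact E) : IsCompact (leftShadow E) :=
  (hE.prod isCompact_Icc).image (by fun_prop)

theorem neg_mem_leftShadow {E : Set ℝ} {y t : ℝ} (hy : y ∈ E) (ht : t ∈ Set.Icc (0 : ℝ) 1) :
    -(Complex.I * y + t) ∈ leftShadow E :=
  ⟨(y, t), ⟨hy, ht⟩, rfl⟩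

theorem neg_I_mul_mem_leftShadow {E : Set ℝ} {y : ℝ} (hy : y ∈ E) :
    -Complex.I * y ∈ leftShadow E := by
  simpa using neg_mem_leftShadow hy (t := 0) (by simp)

theorem re_nonpos_of_mem_leftShadow {E : Set ℝ} {z : ℂ} (hz : z ∈ leftShadow E) : z.re ≤ 0 := by
  obtain ⟨⟨y, t⟩, ⟨-, ht⟩, rfl⟩ := hz
  simpa using ht.1

theorem rightHalfPlane_subset_compl_leftShadow (E : Set ℝ) :
    rightHalfPlane ⊆ (leftShadow E)ᶜ :=
  fun _ hz hK => absurd (re_nonpos_of_mem_leftShadow hK) (not_le.2 hz)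

theorem infDist_leftShadow_le {E : Set ℝ} {y t : ℝ} (hy : y ∈ E) (ht : t ∈ Set.Icc (0 : ℝ) 1)
    (z : ℂ) : Metric.infDist z (leftShadow E) ≤ ‖z + Complex.I * y + t‖ := by
  refine (Metric.infDist_le_dist_of_mem (neg_mem_leftShadow hy ht)).trans (le_of_eq ?_)
  rw [dist_eq_norm]
  congr 1
  ring

theorem exists_norm_add_le_infDist_leftShadow {E : Set ℝ} (hE : IsCompact E) (hne : E.Nonempty)
    {z : ℂ} (hz : z ∈ closedRightHalfPlane) :
    ∃ y ∈ E, ‖z + Complex.I * y‖ ≤ Metric.infDist z (leftShadow E) := by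
  obtain ⟨y₀, hy₀⟩ := hne
  obtain ⟨w, ⟨⟨y, t⟩, ⟨hy, ht⟩, rfl⟩, hw⟩ :=
    (isCompact_leftShadow hE).exists_infDist_eq_dist ⟨_, neg_I_mul_mem_leftShadow hy₀⟩ z
  refine ⟨y, hy, ?_⟩
  have hz' : 0 ≤ z.re := hz
  have ht0 : 0 ≤ t := ht.1
  rw [hw, dist_eq_norm, Complex.norm_def, Complex.norm_def]
  refine Real.sqrt_le_sqrt ?_
  simp only [Complex.normSq_apply, Complex.add_re, Complex.add_im, Complex.sub_re, Complex.sub_im,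
    Complex.neg_re, Complex.neg_im, Complex.mul_re, Complex.mul_im, Complex.I_re, Complex.I_im,
    Complex.ofReal_re, Complex.ofReal_im]
  nlinarith

/-- Holomorphy off `K` may be checked at positive distance from `K`. -/
theorem differentiableOn_compl_of_forall_infDist {K : Set ℂ} (hK : IsClosed K) (hne : K.Nonempty)
    {f : ℂ → ℂ} (h : ∀ ρ : ℝ, 0 < ρ → DifferentiableOn ℂ f {z | ρ < Metric.infDist z K}) :
    DifferentiableOn ℂ f Kᶜ := by
  intro z hz
  have hpos : 0 < Metric.infDist z K := (hK.notMem_iff_infDist_pos hne).1 hz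
  have hopen : IsOpen {w | Metric.infDist z K / 2 < Metric.infDist w K} :=
    isOpen_lt continuous_const (Metric.continuous_infDist_pt K)
  exact ((h _ (half_pos hpos)).differentiableAt
    (hopen.mem_nhds (half_lt_self hpos))).differentiableWithinAt

theorem differentiableOn_div_add {E : Set ℝ} {y a : ℝ} (hy : y ∈ E) (ha : a ∈ Set.Icc (0 : ℝ) 1)
    (c : ℂ) {ρ : ℝ} (hρ : 0 < ρ) :
    DifferentiableOn ℂ (fun z => c / (z + Complex.I * y + a))
      {z | ρ < Metric.infDist z (leftShadow E)} := by
  intro z hz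
  have h0 : z + Complex.I * y + a ≠ 0 :=
    norm_pos_iff.1 (hρ.trans (hz.trans_le (infDist_leftShadow_le hy ha z)))
  exact DifferentiableAt.differentiableWithinAt (by fun_prop (disch := exact h0))

theorem norm_div_add_le {E : Set ℝ} {y a : ℝ} (hy : y ∈ E) (ha : a ∈ Set.Icc (0 : ℝ) 1)
    {ρ : ℝ} (hρ : 0 < ρ) {z : ℂ} (hz : ρ ≤ Metric.infDist z (leftShadow E)) (c : ℂ) :
    ‖c / (z + Complex.I * y + a)‖ ≤ ‖c‖ / ρ := by
  rw [norm_div]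
  have := hz.trans (infDist_leftShadow_le hy ha z)
  gcongr

/-! ### The exponent `F` -/

/-- The `k`-th term of the exponent: a sum of kernels with poles at distance `cantorLength r k`
to the left of the left end points of generation `k`. -/
noncomputable def cantorKernel (r : ℕ → ℝ) (k : ℕ) (z : ℂ) : ℂ :=
  ∑ l ∈ Finset.range (2 ^ k),
    (((k + 1) ^ 3 * cantorLength r k : ℝ) : ℂ) /
      (z + Complex.I * (cantorLeft r k l : ℝ) + (cantorLength r k : ℝ))

/-- The exponent `F`: a superposition of kernels, the real part of which is of order
`(k + 1) ^ 3` at distance `cantorLength r k` from the Cantor set. -/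
noncomputable def cantorPotential (r : ℕ → ℝ) (z : ℂ) : ℂ :=
  ∑' k, cantorKernel r k z

section Potential

variable {r : ℕ → ℝ}

theorem cantorLength_mem_Icc (hr : ∀ k, 0 < r k ∧ r k < 1 / 2) (k : ℕ) :
    cantorLength r k ∈ Set.Icc (0 : ℝ) 1 :=
  ⟨(cantorLength_pos hr k).le, (cantorLength_le_half_pow hr k).trans
    (pow_le_one₀ (by norm_num) (by norm_num))⟩

theorem norm_cantorKernel_le (hr : ∀ k, 0 < r k ∧ r k < 1 / 2) (k : ℕ) {ρ : ℝ} (hρ : 0 < ρ)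
    {z : ℂ} (hz : ρ ≤ Metric.infDist z (leftShadow (cantorTypeSet r))) :
    ‖cantorKernel r k z‖ ≤ (k + 1) ^ 3 * (2 ^ k * cantorLength r k) / ρ := by
  have hL := cantorLength_mem_Icc hr k
  calc ‖cantorKernel r k z‖
      ≤ ∑ l ∈ Finset.range (2 ^ k), ‖(((k + 1) ^ 3 * cantorLength r k : ℝ) : ℂ)‖ / ρ := by
        refine norm_sum_le_of_le _ fun l hl => ?_
        exact norm_div_add_le (cantorLeft_mem_cantorTypeSet hr (Finset.mem_range.1 hl)) hL hρ hz _
    _ = (k + 1) ^ 3 * (2 ^ k * cantorLength r k) / ρ := by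
        rw [Finset.sum_const, Finset.card_range, nsmul_eq_mul, Complex.norm_of_nonneg
          (mul_nonneg (by positivity) hL.1)]
        push_cast
        ring

theorem leftShadow_cantorTypeSet_nonempty (hr : ∀ k, 0 < r k ∧ r k < 1 / 2) :
    (leftShadow (cantorTypeSet r)).Nonempty := by
  obtain ⟨y, hy⟩ := cantorTypeSet_nonempty hr
  exact ⟨_, neg_I_mul_mem_leftShadow hy⟩

theorem isClosed_leftShadow_cantorTypeSet (r : ℕ → ℝ) : IsClosed (leftShadow (cantorTypeSet r)) :=
  (isCompact_leftShadow (isCompact_cantorTypeSet r)).isClosed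

theorem isTempered_cantorPotential (hr : ∀ k, 0 < r k ∧ r k < 1 / 2)
    (hsum : Summable fun k : ℕ => ((k : ℝ) + 1) ^ 3 * (2 ^ k * cantorLength r k)) {b : ℝ}
    (hb : 0 ≤ b) (hLb : ∀ k : ℕ, Real.exp (-(b * (k + 1))) ≤ cantorLength r k) :
    IsTempered (cantorLength r) (leftShadow (cantorTypeSet r)) (cantorPotential r) := by
  have hterm : ∀ k : ℕ, 0 ≤ ((k : ℝ) + 1) ^ 3 * (2 ^ k * cantorLength r k) := fun k => by
    have := cantorLength_pos hr k
    positivity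
  refine isTempered_of_le_exp_sq
    (A := ∑' k : ℕ, ((k : ℝ) + 1) ^ 3 * (2 ^ k * cantorLength r k)) ?_ (tsum_nonneg hterm)
    (c := b) fun k z hz => ?_
  · refine differentiableOn_compl_of_forall_infDist (isClosed_leftShadow_cantorTypeSet r)
      (leftShadow_cantorTypeSet_nonempty hr) fun ρ hρ => ?_
    refine Complex.differentiableOn_tsum_of_summable_norm (hsum.div_const ρ) (fun k => ?_)
      (isOpen_lt continuous_const (Metric.continuous_infDist_pt _))
      fun k z hz => norm_cantorKernel_le hr k hρ (le_of_lt hz)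
    exact DifferentiableOn.fun_sum fun l hl => differentiableOn_div_add
      (cantorLeft_mem_cantorTypeSet hr (Finset.mem_range.1 hl)) (cantorLength_mem_Icc hr k) _ hρ
  · have hL := cantorLength_pos hr k
    have h1 := tsum_of_norm_bounded (hsum.div_const (cantorLength r k)).hasSum
      fun j => norm_cantorKernel_le hr j hL hz
    rw [tsum_div_const, div_eq_mul_inv] at h1
    refine h1.trans ?_
    have h2 : (cantorLength r k)⁻¹ ≤ Real.exp (b * ((k : ℝ) + 1) ^ 2) := by
      rw [inv_le_comm₀ hL (Real.exp_pos _), ← Real.exp_neg]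
      refine le_trans ?_ (hLb k)
      rw [Real.exp_le_exp, neg_le_neg_iff]
      have hk : (0 : ℝ) ≤ k := k.cast_nonneg
      gcongr
      nlinarith
    have h3 : 0 ≤ ∑' k : ℕ, ((k : ℝ) + 1) ^ 3 * (2 ^ k * cantorLength r k) := tsum_nonneg hterm
    gcongr

theorem re_div_add_nonneg {z : ℂ} (hz : z ∈ closedRightHalfPlane) (y : ℝ) {a c : ℝ} (ha : 0 ≤ a)
    (hc : 0 ≤ c) : 0 ≤ ((c : ℂ) / (z + Complex.I * y + a)).re := by
  have hz' : 0 ≤ z.re := hz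
  rw [Complex.div_re]
  simp only [Complex.add_re, Complex.mul_re, Complex.I_re, Complex.I_im, Complex.ofReal_re,
    Complex.ofReal_im, zero_mul, zero_div, add_zero, mul_zero, sub_zero]
  have := Complex.normSq_nonneg (z + Complex.I * y + a)
  positivity

/-- At distance at most `2 * a` from `-i y`, the real part of the kernel is bounded below. -/
theorem le_re_div_add {z : ℂ} (hz : z ∈ closedRightHalfPlane) {y a c : ℝ} (ha : 0 < a)
    (hc : 0 ≤ c) (h : ‖z + Complex.I * y‖ ≤ 2 * a) :
    c / (9 * a) ≤ ((c : ℂ) / (z + Complex.I * y + a)).re := by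
  have hz' : 0 ≤ z.re := hz
  set w := z + Complex.I * y + a with hw
  have hre : a ≤ w.re := by simp [hw, hz']
  have hnorm : ‖w‖ ≤ 3 * a := by
    refine (norm_add_le _ _).trans ?_
    rw [Complex.norm_of_nonneg ha.le]
    linarith
  have hsq : Complex.normSq w ≤ (3 * a) ^ 2 := by
    rw [Complex.normSq_eq_norm_sq]
    gcongr
  have hpos : 0 < Complex.normSq w := by
    refine Complex.normSq_pos.2 fun h0 => ?_
    rw [h0] at hre
    exact absurd hre (not_le.2 ha)
  rw [Complex.div_re, Complex.ofReal_re, Complex.ofReal_im, zero_mul, zero_div, add_zero,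
    div_le_div_iff₀ (by positivity) hpos]
  calc c * Complex.normSq w ≤ c * (3 * a) ^ 2 := by gcongr
    _ = c * a * (9 * a) := by ring
    _ ≤ c * w.re * (9 * a) := by gcongr

theorem le_re_cantorPotential (hr : ∀ k, 0 < r k ∧ r k < 1 / 2)
    (hsum : Summable fun k : ℕ => ((k : ℝ) + 1) ^ 3 * (2 ^ k * cantorLength r k))
    (k : ℕ) (z : ℂ) (hz : z ∈ closedRightHalfPlane)
    (hzK : z ∉ leftShadow (cantorTypeSet r))
    (hd : Metric.infDist z (leftShadow (cantorTypeSet r)) ≤ cantorLength r k) :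
    1 / 9 * ((k : ℝ) + 1) ^ 3 ≤ (cantorPotential r z).re := by
  have hpos := ((isClosed_leftShadow_cantorTypeSet r).notMem_iff_infDist_pos
    (leftShadow_cantorTypeSet_nonempty hr)).1 hzK
  have hL := cantorLength_pos hr k
  have hs : Summable fun k => cantorKernel r k z :=
    Summable.of_norm_bounded (hsum.div_const _) fun j => norm_cantorKernel_le hr j hpos le_rfl
  have hterm : ∀ j l : ℕ, 0 ≤ ((((j + 1) ^ 3 * cantorLength r j : ℝ) : ℂ) /
      (z + Complex.I * (cantorLeft r j l : ℝ) + (cantorLength r j : ℝ))).re := fun j l =>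
    re_div_add_nonneg hz _ (cantorLength_pos hr j).le
      (mul_nonneg (by positivity) (cantorLength_pos hr j).le)
  have hnn : ∀ j, 0 ≤ (cantorKernel r j z).re := fun j => by
    rw [cantorKernel, Complex.re_sum]
    exact Finset.sum_nonneg fun l _ => hterm j l
  -- the interval of generation `k` containing the point of the Cantor set nearest to `z`
  obtain ⟨y, hy, hyd⟩ := exists_norm_add_le_infDist_leftShadow (isCompact_cantorTypeSet r)
    (cantorTypeSet_nonempty hr) hz
  obtain ⟨l, hl, hyl⟩ := mem_cantorTypeSet.1 hy k
  have hnear : ‖z + Complex.I * (cantorLeft r k l : ℝ)‖ ≤ 2 * cantorLength r k := by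
    have h1 : z + Complex.I * (cantorLeft r k l : ℝ) =
        (z + Complex.I * y) - Complex.I * ((y - cantorLeft r k l : ℝ) : ℂ) := by
      push_cast
      ring
    have h2 : ‖Complex.I * ((y - cantorLeft r k l : ℝ) : ℂ)‖ ≤ cantorLength r k := by
      rw [norm_mul, Complex.norm_I, one_mul, Complex.norm_of_nonneg (sub_nonneg.2 hyl.1)]
      linarith [hyl.2]
    rw [h1]
    refine (norm_sub_le _ _).trans ?_
    linarith
  calc 1 / 9 * ((k : ℝ) + 1) ^ 3
      = ((k : ℝ) + 1) ^ 3 * cantorLength r k / (9 * cantorLength r k) := by field_simp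
    _ ≤ ((((k + 1) ^ 3 * cantorLength r k : ℝ) : ℂ) /
          (z + Complex.I * (cantorLeft r k l : ℝ) + (cantorLength r k : ℝ))).re :=
        le_re_div_add hz hL (by positivity) hnear
    _ ≤ (cantorKernel r k z).re := by
        rw [cantorKernel, Complex.re_sum]
        exact Finset.single_le_sum (fun l _ => hterm k l) (Finset.mem_range.2 hl)
    _ ≤ ∑' j, (cantorKernel r j z).re :=
        (Complex.hasSum_re hs.hasSum).summable.le_tsum k fun j _ => hnn j
    _ = (cantorPotential r z).re := (Complex.re_tsum hs).symm

end Potential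

/-! ### The factor `G` -/

/-- The Blaschke product of the right half plane with zeros `L j - i * y j`. -/
noncomputable def blaschkeProduct (L y : ℕ → ℝ) (z : ℂ) : ℂ :=
  ∏' j, (1 + ((-2 * L j : ℝ) : ℂ) / (z + Complex.I * (y j : ℝ) + (L j : ℝ)))

section Blaschke

variable {L y : ℕ → ℝ} {E : Set ℝ}

theorem blaschkeProduct_eq_zero (hL0 : ∀ k, 0 < L k) (j : ℕ) :
    blaschkeProduct L y (L j - Complex.I * y j) = 0 := by
  refine tprod_of_exists_eq_zero ⟨j, ?_⟩
  have h : (L j : ℂ) ≠ 0 := by exact_mod_cast (hL0 j).ne'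
  push_cast
  rw [show (L j : ℂ) - Complex.I * y j + Complex.I * y j + L j = 2 * L j by ring]
  field_simp
  norm_num

theorem blaschkeProduct_two_ne_zero (hL0 : ∀ k, 0 < L k) (hL1 : ∀ k, L k ≤ 1)
    (hsum : Summable L) : blaschkeProduct L y 2 ≠ 0 := by
  have hre : ∀ j, ((2 : ℂ) + Complex.I * y j + L j).re = 2 + L j := fun j => by simp
  have hne : ∀ j, (2 : ℂ) + Complex.I * y j + L j ≠ 0 := fun j h => by
    have h1 := hre j
    rw [h, Complex.zero_re] at h1
    linarith [hL0 j]
  refine tprod_one_add_ne_zero_of_summable (fun j h => ?_) ?_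
  · have h1 : (2 : ℂ) + Complex.I * y j - L j = 0 := by
      have h2 := hne j
      field_simp at h
      push_cast at h
      linear_combination h
    have h3 : ((2 : ℂ) + Complex.I * y j - L j).re = 2 - L j := by simp
    rw [h1, Complex.zero_re] at h3
    linarith [hL1 j]
  · refine Summable.of_nonneg_of_le (fun _ => norm_nonneg _) (fun j => ?_) (hsum.mul_left 2)
    have h1 : 1 ≤ ‖(2 : ℂ) + Complex.I * y j + L j‖ := by
      refine le_trans ?_ (Complex.re_le_norm _)
      rw [hre]
      linarith [hL0 j]
    rw [norm_div, Complex.norm_real, norm_mul, Real.norm_of_nonneg (hL0 j).le]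
    norm_num
    exact div_le_self (by linarith [hL0 j]) h1

theorem isTempered_blaschkeProduct (hE : IsCompact E) (hy : ∀ j, y j ∈ E) (hL0 : ∀ k, 0 < L k)
    (hL1 : L 0 ≤ 1) (hL2 : ∀ k, 2 * L (k + 1) ≤ L k) {b : ℝ} (hb : 0 ≤ b)
    (hLb : ∀ k : ℕ, Real.exp (-(b * (k + 1))) ≤ L k) :
    IsTempered L (leftShadow E) (blaschkeProduct L y) := by
  have hdecay : ∀ k i, L (k + i) ≤ (1 / 2) ^ i * L k := by
    intro k i
    induction i with
    | zero => simp
    | succ i ih =>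
      have := hL2 (k + i)
      rw [pow_succ, ← add_assoc]
      linarith
  have hLI : ∀ j, L j ∈ Set.Icc (0 : ℝ) 1 := fun j => by
    have h1 := hdecay 0 j
    rw [zero_add] at h1
    refine ⟨(hL0 j).le, h1.trans (mul_le_one₀ (pow_le_one₀ (by norm_num) (by norm_num))
      (hL0 0).le hL1)⟩
  have hsum : Summable L := by
    refine Summable.of_nonneg_of_le (fun j => (hL0 j).le) (fun j => ?_)
      ((summable_geometric_of_lt_one (r := (1 / 2 : ℝ)) (by norm_num) (by norm_num)).mul_right
        (L 0))
    simpa using hdecay 0 j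
  have hfac : ∀ {ρ : ℝ}, 0 < ρ → ∀ {z : ℂ}, ρ ≤ Metric.infDist z (leftShadow E) → ∀ j,
      ‖((-2 * L j : ℝ) : ℂ) / (z + Complex.I * (y j : ℝ) + (L j : ℝ))‖ ≤ 2 * L j / ρ := by
    intro ρ hρ z hz j
    refine (norm_div_add_le (hy j) (hLI j) hρ hz _).trans (le_of_eq ?_)
    rw [Complex.norm_real, norm_mul, Real.norm_of_nonneg (hL0 j).le]
    norm_num
  have hprod : ∀ {ρ : ℝ}, 0 < ρ → HasProdLocallyUniformlyOn
      (fun j z => 1 + ((-2 * L j : ℝ) : ℂ) / (z + Complex.I * (y j : ℝ) + (L j : ℝ)))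
      (blaschkeProduct L y) {z | ρ < Metric.infDist z (leftShadow E)} := fun {ρ} hρ =>
    Summable.hasProdLocallyUniformlyOn_nat_one_add
      (isOpen_lt continuous_const (Metric.continuous_infDist_pt _))
      ((hsum.mul_left 2).div_const ρ)
      (Eventually.of_forall fun j z hz => hfac hρ (le_of_lt hz) j)
      (fun j => (differentiableOn_div_add (hy j) (hLI j) _ hρ).continuousOn)
  have hne : (leftShadow E).Nonempty := ⟨_, neg_I_mul_mem_leftShadow (hy 0)⟩
  refine isTempered_of_le_exp_sq (A := Real.exp 4) (c := 2 + b) ?_ (Real.exp_pos _).le ?_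
  · refine differentiableOn_compl_of_forall_infDist (isCompact_leftShadow hE).isClosed hne
      fun ρ hρ => ?_
    refine (hprod hρ).tendstoLocallyUniformlyOn_finsetRange.differentiableOn
      (Eventually.of_forall fun n => ?_)
      (isOpen_lt continuous_const (Metric.continuous_infDist_pt _))
    exact DifferentiableOn.fun_finsetProd fun j _ =>
      (differentiableOn_const 1).add (differentiableOn_div_add (hy j) (hLI j) _ hρ)
  · intro k z hz
    have hLk := hL0 k
    have htend := ((hprod (half_pos hLk)).hasProd
      (show L k / 2 < _ from (half_lt_self hLk).trans_le hz)).tendsto_prod_nat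
    have htend' := ((tendsto_add_atTop_iff_nat k).2 htend).norm
    refine le_of_tendsto' htend' fun m => ?_
    have hone : ∀ j, ‖1 + ((-2 * L j : ℝ) : ℂ) / (z + Complex.I * (y j : ℝ) + (L j : ℝ))‖ ≤
        1 + 2 * L j / L k := fun j => by
      refine (norm_add_le _ _).trans ?_
      rw [norm_one]
      have := hfac hLk hz j
      linarith
    have hk : (0 : ℝ) ≤ k := k.cast_nonneg
    have hinv : (L k)⁻¹ ≤ Real.exp (b * (k + 1)) := by
      rw [inv_le_comm₀ hLk (Real.exp_pos _), ← Real.exp_neg]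
      exact hLb k
    -- the first `k` factors are large, but there are few of them
    have hsmall : ∀ j ∈ Finset.range k, 1 + 2 * L j / L k ≤ Real.exp ((2 + b) * (k + 1)) := by
      intro j _
      have h1 : (1 : ℝ) ≤ (L k)⁻¹ := (one_le_inv₀ hLk).2 (hLI k).2
      have h2 : (3 : ℝ) ≤ Real.exp 2 := by linarith [Real.add_one_le_exp (2 : ℝ)]
      calc 1 + 2 * L j / L k = 1 + 2 * L j * (L k)⁻¹ := by rw [div_eq_mul_inv]
        _ ≤ (L k)⁻¹ + 2 * 1 * (L k)⁻¹ := by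
          have := (hLI j).2
          gcongr
        _ = 3 * (L k)⁻¹ := by ring
        _ ≤ Real.exp 2 * Real.exp (b * (k + 1)) := by gcongr
        _ = Real.exp (2 + b * (k + 1)) := (Real.exp_add _ _).symm
        _ ≤ _ := by
          rw [Real.exp_le_exp]
          nlinarith
    have hlarge : ∀ i ∈ Finset.range m,
        1 + 2 * L (k + i) / L k ≤ Real.exp (2 * (1 / 2) ^ i) := by
      intro i _
      have h1 : L (k + i) / L k ≤ (1 / 2) ^ i := by
        rw [div_le_iff₀ hLk]
        exact hdecay k i
      have h2 := Real.add_one_le_exp (2 * (1 / 2 : ℝ) ^ i)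
      rw [mul_div_assoc]
      linarith
    have hnn : ∀ j, 0 ≤ 1 + 2 * L j / L k := fun j => by
      have := hL0 j
      positivity
    rw [norm_prod, add_comm m k]
    calc ∏ j ∈ Finset.range (k + m),
          ‖1 + ((-2 * L j : ℝ) : ℂ) / (z + Complex.I * (y j : ℝ) + (L j : ℝ))‖
        ≤ ∏ j ∈ Finset.range (k + m), (1 + 2 * L j / L k) :=
          Finset.prod_le_prod (fun j _ => norm_nonneg _) fun j _ => hone j
      _ = (∏ j ∈ Finset.range k, (1 + 2 * L j / L k)) *
            ∏ i ∈ Finset.range m, (1 + 2 * L (k + i) / L k) := Finset.prod_range_add _ _ _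
      _ ≤ (∏ _j ∈ Finset.range k, Real.exp ((2 + b) * (k + 1))) *
            ∏ i ∈ Finset.range m, Real.exp (2 * (1 / 2) ^ i) := by
          refine mul_le_mul (Finset.prod_le_prod (fun j _ => hnn j) hsmall)
            (Finset.prod_le_prod (fun i _ => hnn _) hlarge)
            (Finset.prod_nonneg fun i _ => hnn _) (Finset.prod_nonneg fun i _ => (Real.exp_pos _).le)
      _ = Real.exp (k * ((2 + b) * (k + 1))) *
            Real.exp (2 * ∑ i ∈ Finset.range m, (1 / 2 : ℝ) ^ i) := by
          rw [Finset.prod_const, Finset.card_range, ← Real.exp_nat_mul, ← Real.exp_sum,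
            Finset.mul_sum]
      _ ≤ Real.exp ((2 + b) * (k + 1) ^ 2) * Real.exp 4 := by
          refine mul_le_mul (Real.exp_le_exp.2 ?_) (Real.exp_le_exp.2 ?_) (Real.exp_pos _).le
            (Real.exp_pos _).le
          · have : 0 ≤ (2 + b) * ((k : ℝ) + 1) := by positivity
            nlinarith
          · linarith [sum_geometric_two_le m]
      _ = _ := mul_comm _ _

end Blaschke

/-! ### Choice of the ratios -/

/-- The functions `F` and `G` exist for every set of Cantor type, the intervals of which decay
exponentially, and the generations of which have summable weighted lengths. -/
theorem exists_flat_functions_on_cantorTypeSet {r : ℕ → ℝ} (hr : ∀ k, 0 < r k ∧ r k < 1 / 2)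
    (hsum : Summable fun k : ℕ => ((k : ℝ) + 1) ^ 3 * (2 ^ k * cantorLength r k)) {ρ : ℝ}
    (hρ : 0 < ρ) (hρr : ∀ k, ρ ≤ r k) :
    ∃ F G : ℂ → ℂ,
      DifferentiableOn ℂ F rightHalfPlane ∧
      DifferentiableOn ℂ G rightHalfPlane ∧
      (∃ z ∈ rightHalfPlane, G z ≠ 0) ∧
      ∃ f g : ℂ → ℂ,
        IsSmoothExtension (fun z => Complex.exp (-F z)) f ∧
        IsSmoothExtension (fun z => G z * Complex.exp (-F z)) g ∧
        ∀ y ∈ cantorTypeSet r,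
          VanishesToInfiniteOrderAt f (-Complex.I * (y : ℂ)) ∧
          VanishesToInfiniteOrderAt g (-Complex.I * (y : ℂ)) ∧
          ∃ z : ℕ → ℂ,
            (∀ k, z k ∈ rightHalfPlane) ∧
            Filter.Tendsto z Filter.atTop (nhds (-Complex.I * (y : ℂ))) ∧
            ∀ k, g (z k) = 0 := by
  set L := cantorLength r with hL
  set E := cantorTypeSet r with hE
  have hL0 : ∀ k, 0 < L k := cantorLength_pos hr
  have hL2 : ∀ k, 2 * L (k + 1) ≤ L k := fun k => (two_mul_cantorLength_succ_lt hr k).le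
  have hL1 : ∀ k, L k ≤ 1 := fun k => (cantorLength_mem_Icc hr k).2
  have hLlim : Tendsto L atTop (𝓝 0) := tendsto_cantorLength hr
  have hρ1 : ρ < 1 := (hρr 0).trans_lt ((hr 0).2.trans (by norm_num))
  have hb : 0 ≤ -Real.log ρ := neg_nonneg.2 (Real.log_nonpos hρ.le hρ1.le)
  have hLb : ∀ k : ℕ, Real.exp (-(-Real.log ρ * (k + 1))) ≤ L k := by
    intro k
    have h1 : ρ ^ k ≤ L k := by
      calc ρ ^ k = ∏ _i ∈ Finset.range k, ρ := by simp
        _ ≤ L k := Finset.prod_le_prod (fun _ _ => hρ.le) fun i _ => hρr i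
    refine le_trans ?_ h1
    rw [neg_mul, neg_neg, mul_comm]
    calc Real.exp (((k : ℝ) + 1) * Real.log ρ) = ρ ^ (k + 1) := by
          rw [← Nat.cast_add_one, Real.exp_nat_mul, Real.exp_log hρ]
      _ ≤ ρ ^ k := pow_le_pow_of_le_one hρ.le hρ1.le (Nat.le_succ k)
  -- a sequence in `E` visiting every neighbourhood of every point of `E` infinitely often
  have : Nonempty E := (cantorTypeSet_nonempty hr).to_subtype
  set y : ℕ → ℝ := fun j => (TopologicalSpace.denseSeq E j.unpair.1 : E) with hy
  have hyE : ∀ j, y j ∈ E := fun j => (TopologicalSpace.denseSeq E j.unpair.1).2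
  have hcluster : ∀ x ∈ E, ∀ n : ℕ, ∃ j, n ≤ j ∧ dist (y j) x < 1 / ((n : ℝ) + 1) := by
    intro x hx n
    obtain ⟨i, hi⟩ := (TopologicalSpace.denseRange_denseSeq E).exists_dist_lt ⟨x, hx⟩
      (show (0 : ℝ) < 1 / ((n : ℝ) + 1) by positivity)
    refine ⟨Nat.pair i n, Nat.right_le_pair i n, ?_⟩
    rw [hy]
    dsimp only
    rw [Nat.unpair_pair, dist_comm]
    exact hi
  set K := leftShadow E with hK
  have hKc : IsClosed K := isClosed_leftShadow_cantorTypeSet r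
  have hFt : IsTempered L K (cantorPotential r) := isTempered_cantorPotential hr hsum hb hLb
  have hGt : IsTempered L K (blaschkeProduct L y) :=
    isTempered_blaschkeProduct (isCompact_cantorTypeSet r) hyE hL0 (hL1 0) hL2 hb hLb
  have hsub : rightHalfPlane ⊆ Kᶜ := rightHalfPlane_subset_compl_leftShadow E
  have hLsum : Summable L :=
    Summable.of_nonneg_of_le (fun k => (hL0 k).le) (cantorLength_le_half_pow hr)
      (summable_geometric_of_lt_one (by norm_num) (by norm_num))
  have hflat : ∀ {Q : ℂ → ℂ}, IsTempered L K Q → _ := fun {Q} hQ =>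
    contDiffOn_flatExtension hKc (leftShadow_cantorTypeSet_nonempty hr) hL0 hL2 hLlim hLb
      (show (0 : ℝ) < 1 / 9 by norm_num) (le_re_cantorPotential hr hsum) hFt hQ
  have hmem : ∀ x ∈ E, -Complex.I * (x : ℂ) ∈ K ∧ -Complex.I * (x : ℂ) ∈ closedRightHalfPlane :=
    fun x hx => ⟨neg_I_mul_mem_leftShadow hx, by simp [closedRightHalfPlane]⟩
  have hone : IsTempered L K fun _ => 1 := IsTempered.const 1
  refine ⟨cantorPotential r, blaschkeProduct L y, hFt.1.mono hsub, hGt.1.mono hsub,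
    ⟨2, by simp [rightHalfPlane], blaschkeProduct_two_ne_zero hL0 hL1 hLsum⟩,
    flatExtension K (cantorPotential r) fun _ => 1,
    flatExtension K (cantorPotential r) (blaschkeProduct L y),
    ⟨fun z hz => ?_, (hflat hone).1⟩, ⟨fun z hz => ?_, (hflat hGt).1⟩, fun x hx =>
    ⟨(hflat hone).2 _ (hmem x hx).1 (hmem x hx).2, (hflat hGt).2 _ (hmem x hx).1 (hmem x hx).2, ?_⟩⟩
  · rw [flatExtension_of_notMem (hsub hz), one_mul]
  · exact flatExtension_of_notMem (hsub hz)
  · choose j hj hjx using hcluster x hx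
    have hRHP : ∀ k, (L (j k) : ℂ) - Complex.I * y (j k) ∈ rightHalfPlane := fun k => by
      simp [rightHalfPlane, hL0]
    refine ⟨fun k => L (j k) - Complex.I * y (j k), hRHP, ?_, fun k => ?_⟩
    · have h1 : Tendsto j atTop atTop := tendsto_atTop_mono hj tendsto_id
      have h2 : Tendsto (fun k => y (j k)) atTop (𝓝 x) :=
        tendsto_iff_dist_tendsto_zero.2 (squeeze_zero (fun k => dist_nonneg)
          (fun k => (hjx k).le) tendsto_one_div_add_atTop_nhds_zero_nat)
      have h3 := ((Complex.continuous_ofReal.tendsto _).comp (hLlim.comp h1)).sub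
        (((Complex.continuous_ofReal.tendsto _).comp h2).const_mul Complex.I)
      simpa using h3
    · rw [flatExtension_of_notMem (hsub (hRHP k)), blaschkeProduct_eq_zero hL0, zero_mul]

theorem tendsto_two_pow_mul_cantorLength {r : ℕ → ℝ} (hr : ∀ k, 0 < r k ∧ r k < 1 / 2)
    (hsum : Summable fun k : ℕ => ((k : ℝ) + 1) ^ 3 * (2 ^ k * cantorLength r k)) :
    Tendsto (fun k => 2 ^ k * cantorLength r k) atTop (𝓝 0) := by
  have h0 : ∀ k : ℕ, 0 ≤ 2 ^ k * cantorLength r k := fun k => by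
    have := cantorLength_pos hr k
    positivity
  refine squeeze_zero h0 (fun k => ?_) hsum.tendsto_atTop_zero
  exact le_mul_of_one_le_left (h0 k) (one_le_pow₀ (by simp))

/-- For `s < 1` the ratio is the constant `2 ^ (-1 / s)`. -/
theorem exists_ratios_of_lt_one {s : ℝ} (hs0 : 0 < s) (hs1 : s < 1) :
    ∃ r : ℕ → ℝ, (∀ k, 0 < r k ∧ r k < 1 / 2) ∧ (∀ k, r k ^ s = 1 / 2) ∧
      (Summable fun k : ℕ => ((k : ℝ) + 1) ^ 3 * (2 ^ k * cantorLength r k)) ∧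
      ∃ ρ > 0, ∀ k, ρ ≤ r k := by
  set q : ℝ := (1 / 2) ^ (1 / s) with hq
  have hq0 : 0 < q := by positivity
  have hq2 : q < 1 / 2 := by
    have h := Real.rpow_lt_rpow_of_exponent_gt (x := 1 / 2) (y := 1 / s) (z := 1)
      (by norm_num) (by norm_num) ((one_lt_div hs0).2 hs1)
    rwa [Real.rpow_one] at h
  refine ⟨fun _ => q, fun _ => ⟨hq0, hq2⟩, fun _ => ?_, ?_, q, hq0, fun _ => le_rfl⟩
  · rw [hq, ← Real.rpow_mul (by norm_num), one_div_mul_cancel hs0.ne', Real.rpow_one]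
  · have h1 : Summable fun k : ℕ => (k : ℝ) ^ 3 * (2 * q) ^ k := by
      refine summable_pow_mul_geometric_of_norm_lt_one 3 ?_
      rw [Real.norm_of_nonneg (by positivity)]
      linarith
    refine (((summable_nat_add_iff 1).2 h1).mul_right (2 * q)⁻¹).congr fun k => ?_
    simp only [cantorLength, Finset.prod_const, Finset.card_range]
    push_cast
    field_simp
    ring

/-- For `s = 1` the ratios tend to `1 / 2`, but slowly enough for the total length of the
generation `k` to be `(k + 1) ^ (-5)`. -/
theorem exists_ratios_tendsto_half :
    ∃ r : ℕ → ℝ, (∀ k, 0 < r k ∧ r k < 1 / 2) ∧ Tendsto r atTop (𝓝 (1 / 2)) ∧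
      (Summable fun k : ℕ => ((k : ℝ) + 1) ^ 3 * (2 ^ k * cantorLength r k)) ∧
      ∃ ρ > 0, ∀ k, ρ ≤ r k := by
  set q : ℕ → ℝ := fun k => 1 - 1 / ((k : ℝ) + 2) with hq
  have hq_eq : ∀ k : ℕ, q k = ((k : ℝ) + 1) / (k + 2) := fun k => by
    rw [hq]
    field_simp
    ring
  have hq1 : ∀ k, q k < 1 := fun k => sub_lt_self _ (by positivity)
  have hqhalf : ∀ k, 1 / 2 ≤ q k := fun k => by
    rw [hq_eq, div_le_div_iff₀ (by norm_num) (by positivity)]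
    have : (0 : ℝ) ≤ k := k.cast_nonneg
    linarith
  have hq0 : ∀ k, 0 < q k := fun k => by linarith [hqhalf k]
  have hlen : ∀ k : ℕ, 2 ^ k * cantorLength (fun k => 1 / 2 * q k ^ 5) k =
      1 / ((k : ℝ) + 1) ^ 5 := by
    intro k
    induction k with
    | zero => simp [cantorLength]
    | succ k ih =>
      rw [cantorLength_succ]
      calc (2 : ℝ) ^ (k + 1) * (cantorLength (fun k => 1 / 2 * q k ^ 5) k * (1 / 2 * q k ^ 5))
          = 2 ^ k * cantorLength (fun k => 1 / 2 * q k ^ 5) k * q k ^ 5 := by ring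
        _ = _ := by
          rw [ih, hq_eq]
          push_cast
          field_simp
          ring
  refine ⟨fun k => 1 / 2 * q k ^ 5, fun k => ⟨by have := hq0 k; positivity, ?_⟩, ?_, ?_,
    1 / 2 * (1 / 2) ^ 5, by norm_num, fun k => ?_⟩
  · have := pow_lt_one₀ (hq0 k).le (hq1 k) (n := 5) (by norm_num)
    linarith
  · have h1 : Tendsto (fun k : ℕ => 1 / ((k : ℝ) + 2)) atTop (𝓝 0) := by
      have h := (tendsto_add_atTop_iff_nat 1).2 (tendsto_one_div_add_atTop_nhds_zero_nat (𝕜 := ℝ))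
      refine h.congr fun k => ?_
      push_cast
      ring
    have h2 := ((h1.const_sub 1).pow 5).const_mul (1 / 2)
    simpa [hq] using h2
  · have h1 := (summable_nat_add_iff 1).2 (Real.summable_one_div_nat_pow.2 one_lt_two)
    refine h1.congr fun k => ?_
    rw [hlen]
    push_cast
    field_simp
  · exact mul_le_mul_of_nonneg_left (pow_le_pow_left₀ (by norm_num) (hqhalf k) 5) (by norm_num)

theorem lemma1p1 (s : ℝ) (hs0 : 0 < s) (hs1 : s ≤ 1) :
    ∃ E : Set ℝ,
      E ⊆ Set.Icc 0 1 ∧ IsCompact E ∧ IsNowhereDense E ∧ IsCantorType E ∧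
      (s < 1 → MeasureTheory.Measure.hausdorffMeasure s E = 1) ∧
      (s = 1 → dimH E = 1) ∧
      ∃ F G : ℂ → ℂ,
        DifferentiableOn ℂ F rightHalfPlane ∧
        DifferentiableOn ℂ G rightHalfPlane ∧
        (∃ z ∈ rightHalfPlane, G z ≠ 0) ∧
        ∃ f g : ℂ → ℂ,
          IsSmoothExtension (fun z => Complex.exp (-F z)) f ∧
          IsSmoothExtension (fun z => G z * Complex.exp (-F z)) g ∧
          ∀ y ∈ E,
            VanishesToInfiniteOrderAt f (-Complex.I * (y : ℂ)) ∧
            VanishesToInfiniteOrderAt g (-Complex.I * (y : ℂ)) ∧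
            ∃ z : ℕ → ℂ,
              (∀ k, z k ∈ rightHalfPlane) ∧
              Filter.Tendsto z Filter.atTop (nhds (-Complex.I * (y : ℂ))) ∧
              ∀ k, g (z k) = 0 := by
  obtain ⟨r, hr, hsum, ⟨ρ, hρ, hρr⟩, hH, hD⟩ : ∃ r : ℕ → ℝ, (∀ k, 0 < r k ∧ r k < 1 / 2) ∧
      (Summable fun k : ℕ => ((k : ℝ) + 1) ^ 3 * (2 ^ k * cantorLength r k)) ∧
      (∃ ρ > 0, ∀ k, ρ ≤ r k) ∧
      (s < 1 → Measure.hausdorffMeasure s (cantorTypeSet r) = 1) ∧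
      (s = 1 → dimH (cantorTypeSet r) = 1) := by
    rcases hs1.lt_or_eq with h | h
    · obtain ⟨r, hr, hrs, hsum, hρ⟩ := exists_ratios_of_lt_one hs0 h
      exact ⟨r, hr, hsum, hρ, fun _ => hausdorffMeasure_cantorTypeSet hr hs0 hs1 hrs,
        fun h' => absurd h' h.ne⟩
    · obtain ⟨r, hr, hlim, hsum, hρ⟩ := exists_ratios_tendsto_half
      exact ⟨r, hr, hsum, hρ, fun h' => absurd h h'.ne, fun _ => dimH_cantorTypeSet_eq_one hr hlim⟩
  exact ⟨cantorTypeSet r, cantorTypeSet_subset_Icc r, isCompact_cantorTypeSet r,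
    isNowhereDense_cantorTypeSet (tendsto_two_pow_mul_cantorLength hr hsum), ⟨r, hr, rfl⟩, hH, hD,
    exists_flat_functions_on_cantorTypeSet hr hsum hρ hρr⟩
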